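/- A basic sequence is a sequence $Q=(q_n)_{n\ge1}$ of integers $q_n\ge2$. Every real $x$ has a unique $Q$-Cantor series expansion $x=E_0+\sum_{n\ge1}\frac{E_n}{q_1\cdots q_n}$ with $E_0=\lfloor x\rfloor$, $E_n\in\{0,\dots,q_n-1\}$ and $E_n\ne q_n-1$ for infinitely many $n$; we write $x=E_0.E_1E_2\cdots$ w.r.t. $Q$. For basic sequences $P,Q$ and $x=E_0.E_1E_2\cdots$ w.r.t. $P$, put $\psi_{P,Q}(x)=\sum_{n\ge1}\frac{\min(E_n,q_n-1)}{q_1\cdots q_n}$. A block of length $k$ is a $k$-tuple of non-negative integers. Let $N_n^Q(B,x)$ be the number of occurrences of the block $B$ starting at the positions $1,\dots,n$ in the digit sequence $E_1E_2\cdots$ of $x$ w.r.t. $Q$, and put $Q_n^{(k)}=\sum_{j=1}^n\frac1{q_jq_{j+1}\cdots q_{j+k-1}}$. The sequence $Q$ is infinite in limit if $q_n\to\infty$, and fully divergent if $\lim_n Q_n^{(k)}=\infty$ for all $k\ge1$. Let $\mathscr N(Q)$ be the set of real $x$ with $\lim_n N_n^Q(B,x)/Q_n^{(k)}=1$ for all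 $k\ge1$ and all blocks $B$ of length $k$; let $\mathscr{RN}(Q)$ be the set of real $x$ with $\lim_n N_n^Q(B_1,x)/N_n^Q(B_2,x)=1$ for all $k\ge1$ and all blocks $B_1,B_2$ of length $k$; and let $\mathscr{DN}(Q)$ be the set of real $x$ for which the sequence $(q_1\cdots q_n\,x)_{n\ge0}$ is uniformly distributed mod $1$. For a positive integer $b$ and a block $B=(b_1,\dots,b_k)$ let $\nu_b(B)=\prod_{j=1}^k\nu_b(b_j)$, where $\nu_b(j)=2^{-b}$ for $0\le j\le b-1$, $\nu_b(b)=(2^b-b)/2^b$ and $\nu_b(j)=0$ for $j>b$. Let $V_1,\dots,V_{(b+1)^w}$ be the blocks of length $w$ with digits in $\{0,\dots,b\}$ in lexicographic order, and let $V_{b,w}=V_1^{2^{bw}\nu_b(V_1)}V_2^{2^{bw}\nu_b(V_2)}\cdots V_{(b+1)^w}^{2^{bw}\nu_b(V_{(b+1)^w})}$ (concatenation, exponents denoting repetition). For $i\ge6$ let $W_i=V_{i,i^2}=(w_{i,t})_{t=1}^{|W_i|}$, where $|W_i|=i^22^{i^3}$, and let $l_i=2^{4i^2}$. Let $P=(p_n)$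 be the basic sequence that consists of $l_6|W_6|$ terms equal to $2^6$, followed by $l_7|W_7|$ terms equal to $2^7$, and so on; let $(E_n)_{n\ge1}=W_6^{l_6}W_7^{l_7}W_8^{l_8}\cdots$, and let $\zeta=\sum_{n\ge1}\frac{E_n}{p_1\cdots p_n}$ (the Altomare--Mance number). For each $i\ge6$ portion the positions $t$ with $w_{i,t}=i$ into $i$ classes, numbered $1,\dots,i$, of $i2^{i^3}-i^22^{i^3-i}$ elements each. Let $Q_i=(q_{i,t})_{t=1}^{|W_i|}$, where $q_{i,t}=i$ if $w_{i,t}\in\{0,\dots,i-1\}$; $q_{i,t}=i^3$ if $w_{i,t}=i$ and $t$ is in class $1$; and $q_{i,t}=\lfloor i^2/(j-1)\rfloor$ if $w_{i,t}=i$ and $t$ is in class $j$ with $2\le j\le i$. Put $Q=Q_6^{l_6}Q_7^{l_7}Q_8^{l_8}\cdots$. **Theorem.** Such portionings exist, and for every choice of them $Q$ is a basic sequence that is infinite in limit and fully divergent, and $\psi_{P,Q}(\zeta)\in\big(\mathscr{RN}(Q)\cap\mathscr{DN}(Q)\big)\setminus\mathscr N(Q)$. In particular, there is a basic sequence $Q$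 that is infinite in limit and fully divergent and for which $\mathscr{RN}(Q)\cap\mathscr{DN}(Q)\setminus\mathscr N(Q)\neq\emptyset$. -/

import Mathlib

/-! Sequences `q₁, q₂, …` are functions `ℕ → ℕ` indexed from `0`: the value at `n` is the term with
index `n + 1`. Blocks that are being concatenated are lists of natural numbers. -/

namespace CantorSeries

open Filter Topology

/-! ### Cantor series expansions -/

/-- A basic sequence: all terms are integers that are at least `2`. -/
def IsBasic (Q : ℕ → ℕ) : Prop := ∀ n, 2 ≤ Q n

/-- The product `q₁ q₂ ⋯ qₙ` of the first `n` terms, as a real number. -/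
noncomputable def prodQ (Q : ℕ → ℕ) (n : ℕ) : ℝ := ∏ j ∈ Finset.range n, (Q j : ℝ)

/-- `x = E₀.E₁E₂⋯` with respect to `Q`: here `E₀ = ⌊x⌋`, so that the series of the remaining digits
sums to the fractional part of `x`; `Eₙ ∈ {0, …, qₙ - 1}`, and `Eₙ ≠ qₙ - 1` infinitely often. -/
structure IsCantorExpansion (Q : ℕ → ℕ) (x : ℝ) (E : ℕ → ℕ) : Prop where
  lt : ∀ n, E n < Q n
  frequently : ∃ᶠ n in atTop, E n ≠ Q n - 1
  hasSum : HasSum (fun n => (E n : ℝ) / prodQ Q (n + 1)) (Int.fract x)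

/-- The digits `E₁, E₂, …` of the `Q`-Cantor series expansion of `x` (which exists and is unique,
see `existsUnique_isCantorExpansion`). -/
noncomputable def digits (Q : ℕ → ℕ) (x : ℝ) : ℕ → ℕ := Classical.epsilon (IsCantorExpansion Q x)

theorem prodQ_succ (Q : ℕ → ℕ) (n : ℕ) : prodQ Q (n + 1) = prodQ Q n * Q n :=
  Finset.prod_range_succ _ _

theorem prodQ_pos {Q : ℕ → ℕ} (hQ : IsBasic Q) (n : ℕ) : 0 < prodQ Q n :=
  Finset.prod_pos fun j _ => by have := hQ j; positivity

theorem two_pow_le_prodQ {Q : ℕ → ℕ} (hQ : IsBasic Q) (n : ℕ) : (2 : ℝ) ^ n ≤ prodQ Q n := by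
  induction n with
  | zero => simp [prodQ]
  | succ n ih =>
    rw [prodQ_succ, pow_succ]
    have h2 : (2 : ℝ) ≤ Q n := by exact_mod_cast hQ n
    have := prodQ_pos hQ n
    gcongr

theorem IsCantorExpansion.digit_eq {Q : ℕ → ℕ} (hQ : IsBasic Q) {x : ℝ} {E : ℕ → ℕ}
    (h : IsCantorExpansion Q x E) (n : ℕ) :
    E n = ⌊(Q n : ℝ) * Int.fract (prodQ Q n * x)⌋₊ := by
  set f : ℕ → ℝ := fun n => (E n : ℝ) / prodQ Q (n + 1) with hf
  have hf0 : ∀ j, 0 ≤ f j := fun j => div_nonneg (Nat.cast_nonneg _) (prodQ_pos hQ _).le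
  set R : ℕ → ℝ := fun n => prodQ Q n * (Int.fract x - ∑ j ∈ Finset.range n, f j) with hR
  have hsucc : ∀ n, R (n + 1) = Q n * R n - E n := by
    intro n
    have h1 : prodQ Q (n + 1) * f n = E n := by
      simp only [hf]; field_simp [(prodQ_pos hQ (n + 1)).ne']
    have h2 : R (n + 1) = prodQ Q (n + 1) * (Int.fract x - ∑ j ∈ Finset.range n, f j)
        - prodQ Q (n + 1) * f n := by
      simp only [hR, Finset.sum_range_succ]; ring
    rw [h2, h1, prodQ_succ]; simp only [hR]; ring
  have hnonneg : ∀ n, 0 ≤ R n := fun n => mul_nonneg (prodQ_pos hQ n).le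
    (sub_nonneg.2 (sum_le_hasSum _ (fun j _ => hf0 j) h.hasSum))
  have hpart : ∀ n m, ∑ j ∈ Finset.range (n + m), f j
      ≤ ∑ j ∈ Finset.range n, f j + (1 / prodQ Q n - 1 / prodQ Q (n + m)) := by
    intro n m
    induction m with
    | zero => simp
    | succ m ih =>
      rw [← add_assoc, Finset.sum_range_succ]
      have hE : (E (n + m) : ℝ) + 1 ≤ Q (n + m) := by exact_mod_cast h.lt (n + m)
      have hp := prodQ_pos hQ (n + m + 1)
      have h3 : 1 / prodQ Q (n + m) = Q (n + m) / prodQ Q (n + m + 1) := by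
        have hp' := prodQ_pos hQ (n + m)
        have : (Q (n + m) : ℝ) ≠ 0 := by have := hQ (n + m); positivity
        rw [prodQ_succ]; field_simp
      have h4 : f (n + m) + 1 / prodQ Q (n + m + 1) ≤ 1 / prodQ Q (n + m) := by
        rw [h3]; simp only [hf]; rw [← add_div]; gcongr
      linarith
  have hle : ∀ n, R n ≤ 1 := by
    intro n
    have hb : Int.fract x ≤ ∑ j ∈ Finset.range n, f j + 1 / prodQ Q n := by
      refine le_of_tendsto h.hasSum.tendsto_sum_nat (eventually_atTop.2 ⟨n, fun m hm => ?_⟩)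
      obtain ⟨k, rfl⟩ := Nat.exists_eq_add_of_le hm
      have h1 := hpart n k
      have h2 := one_div_pos.2 (prodQ_pos hQ (n + k))
      linarith
    have hp := prodQ_pos hQ n
    calc R n ≤ prodQ Q n * (1 / prodQ Q n) := by
          simp only [hR]; gcongr; linarith
      _ = 1 := by field_simp
  have hlt : ∀ n, R n < 1 := by
    intro n
    refine lt_of_le_of_ne (hle n) fun h1 => ?_
    have key : ∀ m, R (n + m) = 1 := by
      intro m
      induction m with
      | zero => simpa using h1
      | succ m ih =>
        have h2 := hsucc (n + m)
        rw [ih] at h2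
        have hE : (E (n + m) : ℝ) + 1 ≤ Q (n + m) := by exact_mod_cast h.lt (n + m)
        have h3 := hle (n + m + 1)
        rw [← add_assoc]; linarith
    refine h.frequently (eventually_atTop.2 ⟨n, fun m hm => ?_⟩)
    obtain ⟨k, rfl⟩ := Nat.exists_eq_add_of_le hm
    have h2 := hsucc (n + k)
    rw [key k, add_assoc, key (k + 1)] at h2
    have h3 : (E (n + k) + 1 : ℕ) = Q (n + k) := by
      have : (E (n + k) : ℝ) + 1 = Q (n + k) := by linarith
      exact_mod_cast this
    push Not
    omega
  have hfr : ∀ n, ∃ z : ℤ, prodQ Q n * x - R n = z := by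
    intro n
    induction n with
    | zero => exact ⟨⌊x⌋, by simp [hR, prodQ, Int.self_sub_fract]⟩
    | succ n ih =>
      obtain ⟨z, hz⟩ := ih
      refine ⟨Q n * z + E n, ?_⟩
      push_cast
      rw [hsucc, prodQ_succ, ← hz]; ring
  have hfract : Int.fract (prodQ Q n * x) = R n :=
    Int.fract_eq_iff.2 ⟨hnonneg n, hlt n, hfr n⟩
  rw [hfract, eq_comm, Nat.floor_eq_iff (mul_nonneg (Nat.cast_nonneg _) (hnonneg n))]
  have h1 := hsucc n
  have h2 := hnonneg (n + 1)
  have h3 := hlt (n + 1)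
  constructor <;> linarith

/-- Every real number has exactly one `Q`-Cantor series expansion. -/
theorem existsUnique_isCantorExpansion {Q : ℕ → ℕ} (hQ : IsBasic Q) (x : ℝ) :
    ∃! E, IsCantorExpansion Q x E := by
  set r : ℕ → ℝ := fun n => Int.fract (prodQ Q n * x) with hr
  set d : ℕ → ℕ := fun n => ⌊(Q n : ℝ) * r n⌋₊ with hd
  have hQ0 : ∀ n, (0 : ℝ) < Q n := fun n => by have := hQ n; positivity
  have hr0 : ∀ n, 0 ≤ r n := fun n => Int.fract_nonneg _
  have hr1 : ∀ n, r n < 1 := fun n => Int.fract_lt_one _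
  have hsucc : ∀ n, r (n + 1) = Q n * r n - d n := by
    intro n
    have h0 : 0 ≤ (Q n : ℝ) * r n := mul_nonneg (hQ0 n).le (hr0 n)
    refine Int.fract_eq_iff.2 ⟨sub_nonneg.2 (Nat.floor_le h0), ?_,
      Q n * ⌊prodQ Q n * x⌋ + d n, ?_⟩
    · have := Nat.lt_floor_add_one ((Q n : ℝ) * r n)
      simp only [hd]; linarith
    · have h1 : r n = prodQ Q n * x - ⌊prodQ Q n * x⌋ := rfl
      push_cast
      rw [prodQ_succ, h1]; ring
  have hdlt : ∀ n, d n < Q n := by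
    intro n
    refine (Nat.floor_lt (mul_nonneg (hQ0 n).le (hr0 n))).2 ?_
    have := mul_lt_mul_of_pos_left (hr1 n) (hQ0 n)
    simpa using this
  have hexp : IsCantorExpansion Q x d := by
    refine ⟨hdlt, ?_, ?_⟩
    · intro hev
      obtain ⟨N, hN⟩ := eventually_atTop.1 hev
      have hgrow : ∀ m, 2 ^ m * (1 - r N) ≤ 1 - r (N + m) := by
        intro m
        induction m with
        | zero => simp
        | succ m ih =>
          have h1 := hN (N + m) (by omega)
          push Not at h1
          have h2 : d (N + m) + 1 = Q (N + m) := by have := hQ (N + m); omega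
          have h3 : (d (N + m) : ℝ) + 1 = Q (N + m) := by exact_mod_cast h2
          have h4 := hsucc (N + m)
          have h5 : (2 : ℝ) ≤ Q (N + m) := by exact_mod_cast hQ (N + m)
          have h6 := hr1 (N + m)
          have h7 : 1 - r (N + m + 1) = Q (N + m) * (1 - r (N + m)) := by
            rw [h4]; linarith
          rw [← add_assoc, h7, pow_succ]
          nlinarith
      have hpos : 0 < 1 - r N := by have := hr1 N; linarith
      obtain ⟨m, hm⟩ := pow_unbounded_of_one_lt (1 / (1 - r N)) (one_lt_two : (1 : ℝ) < 2)
      rw [div_lt_iff₀ hpos] at hm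
      have h1 := hgrow m
      have h2 := hr0 (N + m)
      linarith
    · rw [hasSum_iff_tendsto_nat_of_nonneg
        (fun j => div_nonneg (Nat.cast_nonneg _) (prodQ_pos hQ _).le)]
      have hsum : ∀ n, ∑ j ∈ Finset.range n, (d j : ℝ) / prodQ Q (j + 1)
          = Int.fract x - r n / prodQ Q n := by
        intro n
        induction n with
        | zero => simp [hr, prodQ]
        | succ n ih =>
          have hp := prodQ_pos hQ n
          have hq := hQ0 n
          rw [Finset.sum_range_succ, ih, hsucc, prodQ_succ]
          field_simp
          ring
      simp only [hsum]
      have hlim : Tendsto (fun n => r n / prodQ Q n) atTop (𝓝 0) := by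
        refine squeeze_zero (fun n => div_nonneg (hr0 n) (prodQ_pos hQ n).le) (fun n => ?_)
          (tendsto_pow_atTop_nhds_zero_of_lt_one (r := (1 / 2 : ℝ)) (by norm_num) (by norm_num))
        rw [div_pow, one_pow]
        exact div_le_div₀ zero_le_one (hr1 n).le (by positivity) (two_pow_le_prodQ hQ n)
      simpa using hlim.const_sub (Int.fract x)
  exact ⟨d, hexp, fun E hE => funext fun n => hE.digit_eq hQ n⟩

/-- The map `ψ_{P,Q}`: if `x = E₀.E₁E₂⋯` with respect to `P`, then
`ψ_{P,Q}(x) = ∑ₙ min(Eₙ, qₙ - 1) / (q₁ ⋯ qₙ)`. -/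
noncomputable def psi (P Q : ℕ → ℕ) (x : ℝ) : ℝ :=
  ∑' n, ((min (digits P x n) (Q n - 1) : ℕ) : ℝ) / prodQ Q (n + 1)

/-! ### Normality, ratio normality and distribution normality -/

/-- `N_n^Q(B, x)`: the number of occurrences of the block `B` of length `k` that start at one of the
first `n` positions of the `Q`-Cantor series expansion of the fractional part of `x`. -/
noncomputable def blockCount (Q : ℕ → ℕ) {k : ℕ} (B : Fin k → ℕ) (x : ℝ) (n : ℕ) : ℕ :=
  {t ∈ Finset.range n | ∀ j : Fin k, digits Q x (t + j) = B j}.card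

/-- `Q_n^{(k)} = ∑_{j=1}^n 1 / (q_j q_{j+1} ⋯ q_{j+k-1})`. -/
noncomputable def expCount (Q : ℕ → ℕ) (k n : ℕ) : ℝ :=
  ∑ j ∈ Finset.range n, 1 / ∏ i ∈ Finset.range k, (Q (j + i) : ℝ)

/-- `Q` is infinite in limit: `qₙ → ∞`. -/
def InfiniteInLimit (Q : ℕ → ℕ) : Prop := Tendsto Q atTop atTop

/-- `Q` is fully divergent: `Q_n^{(k)} → ∞` for every positive integer `k`. -/
def FullyDivergent (Q : ℕ → ℕ) : Prop := ∀ k, 1 ≤ k → Tendsto (expCount Q k) atTop atTop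

/-- The set `N(Q)` of `Q`-normal numbers. -/
def normalNumbers (Q : ℕ → ℕ) : Set ℝ :=
  {x | ∀ k, 1 ≤ k → ∀ B : Fin k → ℕ,
    Tendsto (fun n => (blockCount Q B x n : ℝ) / expCount Q k n) atTop (𝓝 1)}

/-- The set `RN(Q)` of `Q`-ratio normal numbers. -/
def ratioNormalNumbers (Q : ℕ → ℕ) : Set ℝ :=
  {x | ∀ k, 1 ≤ k → ∀ B₁ B₂ : Fin k → ℕ,
    Tendsto (fun n => (blockCount Q B₁ x n : ℝ) / (blockCount Q B₂ x n : ℝ)) atTop (𝓝 1)}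

/-- The sequence `u` is uniformly distributed mod `1`. -/
def UniformlyDistributedMod1 (u : ℕ → ℝ) : Prop :=
  ∀ a b : ℝ, 0 ≤ a → a < b → b ≤ 1 →
    Tendsto (fun N : ℕ => ({n ∈ Finset.range N | Int.fract (u n) ∈ Set.Ico a b}.card : ℝ) / N)
      atTop (𝓝 (b - a))

/-- `T_{Q,n}(x) = q₁ ⋯ qₙ x (mod 1)`, for `n ≥ 0`. -/
noncomputable def shiftT (Q : ℕ → ℕ) (n : ℕ) (x : ℝ) : ℝ := Int.fract (prodQ Q n * x)

/-- The set `DN(Q)` of `Q`-distribution normal numbers. -/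
def distributionNormalNumbers (Q : ℕ → ℕ) : Set ℝ :=
  {x | UniformlyDistributedMod1 (fun n => shiftT Q n x)}

/-! ### Concatenation of blocks -/

/-- The block `B` repeated `n` times. -/
def blockPow (B : List ℕ) (n : ℕ) : List ℕ := (List.replicate n B).flatten

/-- The finite concatenation `B₀ B₁ ⋯ B_{m-1}`. -/
def concatPrefix (B : ℕ → List ℕ) (m : ℕ) : List ℕ := (List.range m).flatMap B

open Classical in
/-- The infinite concatenation `B₀ B₁ B₂ ⋯` of blocks of which infinitely many are non-empty. -/
noncomputable def infConcat (B : ℕ → List ℕ) (n : ℕ) : ℕ :=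
  if h : ∃ m, n < (concatPrefix B m).length then (concatPrefix B (Nat.find h)).getD n 0 else 0

/-! ### The Altomare–Mance blocks, basic sequence and number -/

/-- The weights `ν_b((j))` of the digits. -/
def nu (b j : ℕ) : ℚ :=
  if j < b then 1 / 2 ^ b else if j = b then (2 ^ b - b) / 2 ^ b else 0

/-- `ν_b(B)` is the product of the weights of the digits of `B`. -/
def nuBlock (b : ℕ) (B : List ℕ) : ℚ := (B.map (nu b)).prod

/-- All blocks of length `w` in base `m`, in lexicographic order. -/
def lexBlocks (m : ℕ) : ℕ → List (List ℕ)
  | 0 => [[]]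
  | w + 1 => (List.range m).flatMap fun d => (lexBlocks m w).map fun B => d :: B

/-- The multiplicity `2^{bw} ν_b(B)` of the block `B` of length `w`; it is an integer, so that the
floor changes nothing (see `cast_multiplicity`). -/
def multiplicity (b w : ℕ) (B : List ℕ) : ℕ := ⌊(2 : ℚ) ^ (b * w) * nuBlock b B⌋₊

theorem cast_multiplicity (b w : ℕ) (B : List ℕ) (hB : B.length = w) :
    (multiplicity b w B : ℚ) = 2 ^ (b * w) * nuBlock b B := by
  have key : ∃ m : ℕ, (m : ℚ) = 2 ^ (b * w) * nuBlock b B := by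
    subst hB
    induction B with
    | nil => exact ⟨1, by simp [nuBlock]⟩
    | cons j B ih =>
      obtain ⟨m, hm⟩ := ih
      have hj : ∃ c : ℕ, (c : ℚ) = 2 ^ b * nu b j := by
        unfold nu
        split_ifs
        · exact ⟨1, by field_simp; norm_num⟩
        · exact ⟨2 ^ b - b, by rw [Nat.cast_sub Nat.lt_two_pow_self.le]; push_cast; field_simp⟩
        · exact ⟨0, by simp⟩
      obtain ⟨c, hc⟩ := hj
      refine ⟨c * m, ?_⟩
      push_cast
      rw [hc, hm]
      simp only [nuBlock, List.map_cons, List.prod_cons, List.length_cons, mul_add, pow_add,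
        mul_one]
      ring
  obtain ⟨m, hm⟩ := key
  rw [multiplicity, ← hm, Nat.floor_natCast]

/-- The block `V_{b,w}`: the blocks of length `w` in base `b + 1`, in lexicographic order, each
repeated `2^{bw} ν_b(·)` times. -/
def blockV (b w : ℕ) : List ℕ :=
  (lexBlocks (b + 1) w).flatMap fun B => blockPow B (multiplicity b w B)

/-- `W_i = V_{i,i²}`. -/
def blockW (i : ℕ) : List ℕ := blockV i (i ^ 2)

/-- The number of repetitions: `l_i = 2^{4i²}` for `i ≥ 6`, and `l_i = 0` for `i ≤ 5`. -/
def reps (i : ℕ) : ℕ := if i ≤ 5 then 0 else 2 ^ (4 * i ^ 2)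

/-- The basic sequence `P`, which has `l_i |W_i|` consecutive terms equal to `2^i`, for
`i = 6, 7, …` in this order. -/
noncomputable def seqP : ℕ → ℕ :=
  infConcat fun i => List.replicate (reps i * (blockW i).length) (2 ^ i)

/-- The digits of the Altomare–Mance number: the infinite block `W_6^{l_6} W_7^{l_7} ⋯`. -/
noncomputable def zetaDigits : ℕ → ℕ := infConcat fun i => blockPow (blockW i) (reps i)

/-- The Altomare–Mance number `ζ = ∑ₙ Eₙ / (p₁ ⋯ pₙ)`. -/
noncomputable def zeta : ℝ := ∑' n, (zetaDigits n : ℝ) / prodQ seqP (n + 1)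

/-! ### The basic sequence `Q` -/

/-- For each `i ≥ 6`, the function `g i` portions the positions `t` of `W_i` that carry the digit
`i` into `i` classes, numbered `1, …, i`, of `i 2^{i³} - i² 2^{i³-i}` elements each. -/
structure IsGrouping (g : ℕ → ℕ → ℕ) : Prop where
  mem : ∀ i, 6 ≤ i → ∀ t, t < (blockW i).length → (blockW i).getD t 0 = i → g i t ∈ Finset.Icc 1 i
  card : ∀ i, 6 ≤ i → ∀ c ∈ Finset.Icc 1 i,
    {t ∈ Finset.range (blockW i).length | (blockW i).getD t 0 = i ∧ g i t = c}.card
      = i * 2 ^ (i ^ 3) - i ^ 2 * 2 ^ (i ^ 3 - i)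

/-- The block `Q_i`, of the same length as `W_i`: the entry is `i` where `W_i` has a digit less than
`i`; where `W_i` has the digit `i`, the entry is `i³` on class `1` and `⌊i² / (j - 1)⌋` on class `j`,
for `2 ≤ j ≤ i`. -/
def blockQ (g : ℕ → ℕ → ℕ) (i : ℕ) : List ℕ :=
  (blockW i).mapIdx fun t w =>
    if w < i then i else if g i t = 1 then i ^ 3 else i ^ 2 / (g i t - 1)

/-- The basic sequence `Q = Q_6^{l_6} Q_7^{l_7} Q_8^{l_8} ⋯`. -/
noncomputable def seqQ (g : ℕ → ℕ → ℕ) : ℕ → ℕ :=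
  infConcat fun i => blockPow (blockQ g i) (reps i)

end CantorSeries

/-! The digit `Eₙ` of `ζ` is smaller than the term `qₙ` everywhere, so that `ψ_{P,Q}` leaves the
digits of `ζ` unchanged (`digits_psi`): all statements on `x = ψ_{P,Q}(ζ)` concern the digit
sequence `W_6^{l_6} W_7^{l_7} ⋯` and the sequence `Q`, which runs through the copies of `W_i` in
parallel.

Averages of a bounded function along this sequence are controlled by its sums over the single
copies of `W_i` (`tendsto_sum_div_weight`): the repetition numbers `l_i` are so large that one
incomplete copy is negligible in comparison with what precedes it, even when the position `t` has
only the weight `p_t^{-k} = 2^{-ik}`.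

*Ratio normality.* Under the weights `ν_i` the digits of a block of length `i²` are independent,
so each block `B` of length `k` with digits less than `i` has the same total number
`i² 2^{i³ - ik}` of cyclic occurrences in the blocks that make up `W_i`
(`sum_multiplicity_mul_cyclicCount`). Since equal blocks stand next to each other in `W_i`, cyclic
occurrences are real ones, except for at most `k` positions for each of the `(i + 1)^{i²}` different
blocks, and `(i + 1)^{i²}` is negligible in comparison with `i² 2^{i³ - ik}`. Hence
`N_n(B) ∼ ∑_{t ≤ n} p_t^{-k}` for all `B` of length `k` (`tendsto_sum_occ_div_weight`).

*Failure of normality, and full divergence.* As `q_t ≤ i³` where `p_t = 2^i`, every constant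
multiple of `q_t` is eventually at most `p_t`. So `Q_n^{(k)}` is at least `∑_{t ≤ n} p_t^{-k}` up
to a constant, which diverges, and for `k = 1` it is at least twice this sum up to a constant,
hence not asymptotic to `N_n(B)`.

*Distribution normality.* If `q_{n+1}` belongs to a position with the digit `i` in class `c`, then
`q_1 ⋯ q_n x` mod 1 lies in `[(c - 1)/i, (c + 1)/i)` (`shiftT_mem_of_class`). The `i` classes have
the same size and make up almost all of `W_i`, which gives uniform distribution. -/

namespace CantorSeries

open Filter Topology

/-! ### Positions in a concatenation of blocks -/

theorem concatPrefix_succ (B : ℕ → List ℕ) (m : ℕ) :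
    concatPrefix B (m + 1) = concatPrefix B m ++ B m := by
  simp [concatPrefix, List.range_succ]

theorem length_concatPrefix (B : ℕ → List ℕ) (m : ℕ) :
    (concatPrefix B m).length = ∑ j ∈ Finset.range m, (B j).length := by
  induction m with
  | zero => simp [concatPrefix]
  | succ m ih => rw [concatPrefix_succ, List.length_append, ih, Finset.sum_range_succ]

theorem infConcat_add {B : ℕ → List ℕ} {m t : ℕ} (ht : t < (B m).length) :
    infConcat B ((concatPrefix B m).length + t) = (B m).getD t 0 := by
  classical
  have hex : ∃ m', (concatPrefix B m).length + t < (concatPrefix B m').length :=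
    ⟨m + 1, by rw [concatPrefix_succ, List.length_append]; omega⟩
  have hfind : Nat.find hex = m + 1 := by
    rw [Nat.find_eq_iff]
    refine ⟨by rw [concatPrefix_succ, List.length_append]; omega, fun n hn => ?_⟩
    have : (concatPrefix B n).length ≤ (concatPrefix B m).length := by
      rw [length_concatPrefix, length_concatPrefix]
      exact Finset.sum_le_sum_of_subset (Finset.range_mono (by omega))
    omega
  have : infConcat B ((concatPrefix B m).length + t)
      = (concatPrefix B (Nat.find hex)).getD ((concatPrefix B m).length + t) 0 := by
    unfold infConcat
    rw [dif_pos hex]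
  rw [this, hfind, concatPrefix_succ, List.getD_append_right _ _ _ _ (by omega)]
  congr 1
  omega

theorem blockPow_succ (B : List ℕ) (n : ℕ) : blockPow B (n + 1) = B ++ blockPow B n := by
  simp [blockPow, List.replicate_succ]

theorem length_blockPow (B : List ℕ) (n : ℕ) : (blockPow B n).length = n * B.length := by
  simp [blockPow]

theorem getD_blockPow (B : List ℕ) {n r u : ℕ} (hr : r < n) (hu : u < B.length) :
    (blockPow B n).getD (r * B.length + u) 0 = B.getD u 0 := by
  induction n generalizing r with
  | zero => omega
  | succ n ih =>
    rw [blockPow_succ]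
    rcases r with _ | r
    · rw [zero_mul, zero_add, List.getD_append _ _ _ _ hu]
    · rw [List.getD_append_right _ _ _ _ (by rw [add_mul]; omega), ← ih (r := r) (by omega)]
      congr 1
      rw [add_mul]
      omega

theorem count_blockPow (B : List ℕ) (a n : ℕ) : (blockPow B n).count a = n * B.count a := by
  induction n with
  | zero => simp [blockPow]
  | succ n ih => rw [blockPow_succ, List.count_append, ih]; ring

theorem card_filter_getD_eq_count (B : List ℕ) (a : ℕ) :
    {t ∈ Finset.range B.length | B.getD t 0 = a}.card = B.count a := by
  rw [Finset.card_filter]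
  induction B with
  | nil => simp
  | cons b B ih =>
    rw [List.length_cons, Finset.sum_range_succ', List.count_cons, ← ih]
    simp

/-! ### Weighted sums over the blocks of a given length -/

theorem length_lexBlocks (m w : ℕ) : (lexBlocks m w).length = m ^ w := by
  induction w with
  | zero => simp [lexBlocks]
  | succ w ih =>
    rw [lexBlocks, List.length_flatMap, pow_succ, mul_comm]
    simp [ih]

theorem length_of_mem_lexBlocks {m w : ℕ} {V : List ℕ} (hV : V ∈ lexBlocks m w) :
    V.length = w := by
  induction w generalizing V with
  | zero => simp_all [lexBlocks]
  | succ w ih =>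
    simp only [lexBlocks, List.mem_flatMap, List.mem_map] at hV
    obtain ⟨d, -, V', hV', rfl⟩ := hV
    simp [ih hV']

theorem lt_of_mem_of_mem_lexBlocks {m w : ℕ} {V : List ℕ} (hV : V ∈ lexBlocks m w) {d : ℕ}
    (hd : d ∈ V) : d < m := by
  induction w generalizing V with
  | zero => simp_all [lexBlocks]
  | succ w ih =>
    simp only [lexBlocks, List.mem_flatMap, List.mem_map, List.mem_range] at hV
    obtain ⟨e, he, V', hV', rfl⟩ := hV
    rcases List.mem_cons.1 hd with rfl | hd
    · exact he
    · exact ih hV' hd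

/-- Summing a product of functions of the single digits over all blocks of length `w`. -/
theorem sum_lexBlocks_prod (m w : ℕ) (φ : ℕ → ℕ → ℚ) :
    ((lexBlocks m w).map fun V => ∏ j ∈ Finset.range w, φ j (V.getD j 0)).sum
      = ∏ j ∈ Finset.range w, ∑ d ∈ Finset.range m, φ j d := by
  induction w generalizing φ with
  | zero => simp [lexBlocks]
  | succ w ih =>
    have key : ∀ n, (((List.range n).flatMap fun d => (lexBlocks m w).map fun B => d :: B).map
        fun V => ∏ j ∈ Finset.range (w + 1), φ j (V.getD j 0)).sum
          = ∑ d ∈ Finset.range n,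
            (∏ j ∈ Finset.range w, ∑ e ∈ Finset.range m, φ (j + 1) e) * φ 0 d := by
      intro n
      induction n with
      | zero => simp
      | succ n ihn =>
        rw [List.range_succ, List.flatMap_append, List.map_append, List.sum_append, ihn,
          Finset.sum_range_succ, ← ih fun j e => φ (j + 1) e, ← List.sum_map_mul_right]
        simp [Finset.prod_range_succ', Function.comp_def]
    rw [lexBlocks, key, Finset.prod_range_succ', Finset.mul_sum]

theorem nuBlock_eq_prod (b : ℕ) (V : List ℕ) :
    nuBlock b V = ∏ j ∈ Finset.range V.length, nu b (V.getD j 0) := by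
  induction V with
  | nil => simp [nuBlock]
  | cons d V ih =>
    rw [List.length_cons, Finset.prod_range_succ']
    simp only [nuBlock, List.map_cons, List.prod_cons] at ih ⊢
    rw [ih, mul_comm]
    simp

theorem nu_of_lt {b j : ℕ} (h : j < b) : nu b j = 1 / 2 ^ b := by simp [nu, h]

theorem nu_self (b : ℕ) : nu b b = (2 ^ b - b) / 2 ^ b := by simp [nu]

theorem sum_nu (b : ℕ) : ∑ d ∈ Finset.range (b + 1), nu b d = 1 := by
  rw [Finset.sum_range_succ, Finset.sum_congr rfl fun d hd => nu_of_lt (Finset.mem_range.1 hd),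
    nu_self, Finset.sum_const, Finset.card_range, nsmul_eq_mul]
  field_simp
  ring

/-- The total multiplicity of the blocks that have prescribed digits `τ j` at the positions
`j ∈ S`: under the product weights the positions are independent. -/
theorem sum_multiplicity_prescribed (b w : ℕ) (S : Finset ℕ) (hS : S ⊆ Finset.range w) (τ : ℕ → ℕ)
    (hτ : ∀ j ∈ S, τ j ≤ b) :
    ((lexBlocks (b + 1) w).map fun V =>
        (multiplicity b w V : ℚ) * if ∀ j ∈ S, V.getD j 0 = τ j then 1 else 0).sum
      = 2 ^ (b * w) * ∏ j ∈ S, nu b (τ j) := by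
  have h1 : ((lexBlocks (b + 1) w).map fun V =>
        (multiplicity b w V : ℚ) * if ∀ j ∈ S, V.getD j 0 = τ j then 1 else 0)
      = (lexBlocks (b + 1) w).map fun V => 2 ^ (b * w) * ∏ j ∈ Finset.range w,
          (nu b (V.getD j 0) * if j ∈ S → V.getD j 0 = τ j then 1 else 0) := by
    refine List.map_congr_left fun V hV => ?_
    have hlen := length_of_mem_lexBlocks hV
    rw [cast_multiplicity b w V hlen, nuBlock_eq_prod, hlen, Finset.prod_mul_distrib, mul_assoc]
    congr 2
    by_cases h : ∀ j ∈ S, V.getD j 0 = τ j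
    · rw [if_pos h, Finset.prod_eq_one fun j _ => if_pos (h j)]
    · rw [if_neg h]
      push Not at h
      obtain ⟨j, hj, hne⟩ := h
      exact (Finset.prod_eq_zero (hS hj) (if_neg fun h' => hne (h' hj))).symm
  rw [h1, List.sum_map_mul_left, sum_lexBlocks_prod (b + 1) w
    fun j d => nu b d * if j ∈ S → d = τ j then 1 else 0]
  congr 1
  rw [← Finset.prod_subset hS fun j _ hj => ?_]
  · refine Finset.prod_congr rfl fun j hj => ?_
    simp only [hj, forall_const, mul_ite, mul_one, mul_zero]
    rw [Finset.sum_ite_eq', if_pos (Finset.mem_range.2 (Nat.lt_succ_of_le (hτ j hj)))]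
  · simp only [hj, IsEmpty.forall_iff, if_true, mul_one, sum_nu]

theorem sum_multiplicity (b w : ℕ) :
    ((lexBlocks (b + 1) w).map fun V => multiplicity b w V).sum = 2 ^ (b * w) := by
  have := sum_multiplicity_prescribed b w ∅ (by simp) (fun _ => 0) (by simp)
  simp only [Finset.notMem_empty, IsEmpty.forall_iff, implies_true, if_true, mul_one,
    Finset.prod_empty] at this
  rw [← Nat.cast_inj (R := ℚ), Nat.cast_list_sum, List.map_map]
  push_cast
  exact this

theorem length_blockV (b w : ℕ) : (blockV b w).length = w * 2 ^ (b * w) := by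
  rw [blockV, List.length_flatMap, ← sum_multiplicity b w, ← List.sum_map_mul_left]
  refine congrArg List.sum (List.map_congr_left fun V hV => ?_)
  rw [length_blockPow, length_of_mem_lexBlocks hV, mul_comm]

theorem length_blockW (i : ℕ) : (blockW i).length = i ^ 2 * 2 ^ (i ^ 3) := by
  rw [blockW, length_blockV]; ring

theorem getD_blockW_le {i u : ℕ} (hu : u < (blockW i).length) : (blockW i).getD u 0 ≤ i := by
  have h : (blockW i).getD u 0 ∈ blockW i := by
    rw [List.getD_eq_getElem _ _ hu]
    exact List.getElem_mem hu
  generalize (blockW i).getD u 0 = d at h ⊢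
  simp only [blockW, blockV, List.mem_flatMap, blockPow, List.mem_flatten, List.mem_replicate] at h
  obtain ⟨V, hV, l, ⟨-, rfl⟩, hd⟩ := h
  exact Nat.le_of_lt_succ (lt_of_mem_of_mem_lexBlocks hV hd)

theorem sum_map_sum_range (w : ℕ) (l : List (List ℕ)) (φ : List ℕ → ℕ → ℚ) :
    (l.map fun V => ∑ u ∈ Finset.range w, φ V u).sum
      = ∑ u ∈ Finset.range w, (l.map fun V => φ V u).sum := by
  induction l with
  | nil => simp
  | cons V l ih => simp [ih, Finset.sum_add_distrib]

theorem count_self_blockV (b w : ℕ) :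
    ((blockV b w).count b : ℚ) = w * (2 ^ (b * w) * ((2 ^ b - b) / 2 ^ b)) := by
  have h1 : ((blockV b w).count b : ℚ) = ((lexBlocks (b + 1) w).map fun V =>
      ∑ u ∈ Finset.range w, (multiplicity b w V : ℚ) *
        if ∀ j ∈ ({u} : Finset ℕ), V.getD j 0 = b then 1 else 0).sum := by
    rw [blockV, List.count_flatMap, Nat.cast_list_sum, List.map_map]
    refine congrArg List.sum (List.map_congr_left fun V hV => ?_)
    simp only [Function.comp, count_blockPow, Nat.cast_mul, ← Finset.mul_sum,
      Finset.mem_singleton, forall_eq]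
    rw [← card_filter_getD_eq_count, length_of_mem_lexBlocks hV, Finset.card_filter]
    push_cast
    rfl
  rw [h1, sum_map_sum_range, Finset.sum_congr rfl fun u hu => sum_multiplicity_prescribed b w {u}
    (by simpa using hu) (fun _ => b) (by simp)]
  simp [nu_self]

/-! ### Occurrences of a block -/

/-- The indicator of the event that the block `B` occurs in the sequence `s` at position `t`. -/
def occ (s : ℕ → ℕ) {k : ℕ} (B : Fin k → ℕ) (t : ℕ) : ℝ :=
  if ∀ j : Fin k, s (t + j) = B j then 1 else 0

theorem occ_nonneg (s : ℕ → ℕ) {k : ℕ} (B : Fin k → ℕ) (t : ℕ) : 0 ≤ occ s B t := by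
  unfold occ; split_ifs <;> norm_num

theorem occ_le_one (s : ℕ → ℕ) {k : ℕ} (B : Fin k → ℕ) (t : ℕ) : occ s B t ≤ 1 := by
  unfold occ; split_ifs <;> norm_num

/-- The number of occurrences of `B` in the block `V` bent to a circle. -/
def cyclicCount (V : List ℕ) {k : ℕ} (B : Fin k → ℕ) : ℕ :=
  {o ∈ Finset.range V.length | ∀ j : Fin k, V.getD ((o + j) % V.length) 0 = B j}.card

theorem card_cyclic_mul (V : List ℕ) {k : ℕ} (B : Fin k → ℕ) (m : ℕ) :
    {t ∈ Finset.range (m * V.length) | ∀ j : Fin k, V.getD ((t + j) % V.length) 0 = B j}.card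
      = m * cyclicCount V B := by
  rw [cyclicCount, Finset.card_filter, Finset.card_filter]
  induction m with
  | zero => simp
  | succ m ih =>
    rw [add_mul, one_mul, Finset.sum_range_add, ih, add_mul, one_mul]
    simp only [add_assoc, Nat.mul_add_mod_self_right]

/-- In `m` copies of `V`, a block `B` of length `k` occurs `m` times as often as in the circle `V`,
except that the last `k` positions may see what follows the copies. -/
theorem abs_sum_occ_blockPow_sub_le (V : List ℕ) (m : ℕ) {k : ℕ} (B : Fin k → ℕ) (s : ℕ → ℕ)
    (hs : ∀ t < m * V.length, s t = (blockPow V m).getD t 0) :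
    |∑ t ∈ Finset.range (m * V.length), occ s B t - m * cyclicCount V B| ≤ k := by
  have hs' : ∀ t < m * V.length, s t = V.getD (t % V.length) 0 := by
    intro t ht
    have hV : 0 < V.length := Nat.pos_of_ne_zero fun h => by simp [h] at ht
    have h1 := getD_blockPow V (r := t / V.length) (n := m)
      ((Nat.div_lt_iff_lt_mul hV).2 ht) (Nat.mod_lt t hV)
    rw [hs t ht, ← h1, mul_comm, Nat.div_add_mod]
  have h2 : (m * cyclicCount V B : ℝ) = ∑ t ∈ Finset.range (m * V.length),
      if ∀ j : Fin k, V.getD ((t + j) % V.length) 0 = B j then (1 : ℝ) else 0 := by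
    rw [← Nat.cast_mul, ← card_cyclic_mul, Finset.card_filter]
    push_cast
    rfl
  rw [h2, ← Finset.sum_sub_distrib]
  refine (Finset.abs_sum_le_sum_abs _ _).trans ?_
  calc _ ≤ ∑ t ∈ Finset.range (m * V.length), if m * V.length - k ≤ t then (1 : ℝ) else 0 := by
        refine Finset.sum_le_sum fun t ht => ?_
        have ht := Finset.mem_range.1 ht
        by_cases h : m * V.length - k ≤ t
        · rw [if_pos h, occ]
          split_ifs <;> norm_num
        · have : (∀ j : Fin k, s (t + j) = B j) ↔
              ∀ j : Fin k, V.getD ((t + j) % V.length) 0 = B j :=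
            forall_congr' fun j => by rw [hs' _ (by have := j.2; omega)]
          simp only [occ, this, if_neg h, sub_self, abs_zero, le_refl]
    _ = (({t ∈ Finset.range (m * V.length) | m * V.length - k ≤ t}.card : ℕ) : ℝ) := by
        rw [Finset.card_filter]
        push_cast
        rfl
    _ ≤ k := by
        rw [Nat.cast_le]
        calc _ ≤ (Finset.Ico (m * V.length - k) (m * V.length)).card :=
              Finset.card_le_card fun t ht => by
                simp only [Finset.mem_filter, Finset.mem_range, Finset.mem_Ico] at ht ⊢
                omega
          _ ≤ k := by rw [Nat.card_Ico]; omega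

theorem abs_sum_occ_flatMap_sub_le (l : List (List ℕ)) (μ : List ℕ → ℕ) {k : ℕ} (B : Fin k → ℕ)
    (s : ℕ → ℕ) (p : ℕ)
    (hs : ∀ t < (l.flatMap fun V => blockPow V (μ V)).length,
      s (p + t) = (l.flatMap fun V => blockPow V (μ V)).getD t 0) :
    |∑ t ∈ Finset.range (l.flatMap fun V => blockPow V (μ V)).length, occ s B (p + t)
      - ((l.map fun V => μ V * cyclicCount V B).sum : ℕ)| ≤ k * l.length := by
  induction l generalizing p with
  | nil => simp
  | cons V l ih =>
    simp only [List.flatMap_cons, List.length_append, length_blockPow, List.map_cons,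
      List.sum_cons, List.length_cons] at hs ⊢
    have h1 := abs_sum_occ_blockPow_sub_le V (μ V) B (fun t => s (p + t)) fun t ht => by
      rw [hs t (by omega), List.getD_append _ _ _ _ (by rwa [length_blockPow])]
    have h2 := ih (p + μ V * V.length) fun t ht => by
      rw [add_assoc, hs _ (by omega), List.getD_append_right _ _ _ _
        (by rw [length_blockPow]; omega), length_blockPow, Nat.add_sub_cancel_left]
    have h3 : ∀ t, occ (fun t => s (p + t)) B t = occ s B (p + t) := fun t => by
      simp only [occ, add_assoc]
    simp only [h3] at h1
    rw [Finset.sum_range_add]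
    simp only [← add_assoc]
    push_cast at h1 h2 ⊢
    rw [abs_le] at *
    constructor <;> linarith [h1.1, h1.2, h2.1, h2.2]

/-- Summed over the blocks of `V_{b,w}`, all blocks `B` of length `k` with digits less than `b` have
the same number of cyclic occurrences. -/
theorem sum_multiplicity_mul_cyclicCount {b w k : ℕ} (hk : k ≤ w) (B : Fin k → ℕ)
    (hB : ∀ j, B j < b) :
    ((lexBlocks (b + 1) w).map fun V => multiplicity b w V * cyclicCount V B).sum
      = w * 2 ^ (b * (w - k)) := by
  have hinj : ∀ o, Function.Injective fun a : Fin k => (o + a) % w := fun o a c hac =>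
    Fin.ext ((Nat.ModEq.add_left_cancel' o hac).eq_of_lt_of_lt (a.2.trans_le hk) (c.2.trans_le hk))
  let S : ℕ → Finset ℕ := fun o => Finset.univ.image fun a : Fin k => (o + a) % w
  obtain ⟨τ, hτ⟩ : ∃ τ : ℕ → ℕ → ℕ, ∀ o, ∀ a : Fin k, τ o ((o + a) % w) = B a :=
    ⟨fun o => Function.extend (fun a : Fin k => (o + a) % w) B 0,
      fun o a => (hinj o).extend_apply B 0 a⟩
  rw [← Nat.cast_inj (R := ℚ), Nat.cast_list_sum, List.map_map]
  have h1 : (lexBlocks (b + 1) w).map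
        ((Nat.cast : ℕ → ℚ) ∘ fun V => multiplicity b w V * cyclicCount V B)
      = (lexBlocks (b + 1) w).map fun V => ∑ o ∈ Finset.range w, (multiplicity b w V : ℚ) *
        if ∀ j ∈ S o, V.getD j 0 = τ o j then 1 else 0 := by
    refine List.map_congr_left fun V hV => ?_
    simp only [S, Function.comp, Nat.cast_mul, ← Finset.mul_sum, Finset.forall_mem_image,
      Finset.mem_univ, forall_const, hτ]
    rw [cyclicCount, length_of_mem_lexBlocks hV, Finset.card_filter]
    push_cast
    rfl
  rw [h1, sum_map_sum_range, Finset.sum_congr rfl fun o ho => ?_, Finset.sum_const,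
    Finset.card_range, nsmul_eq_mul]
  · push_cast
    rfl
  · rw [sum_multiplicity_prescribed, Finset.prod_image fun a _ c _ h => hinj o h]
    · simp only [hτ, nu_of_lt (hB _), Finset.prod_const, Finset.card_univ,
        Fintype.card_fin]
      rw [Nat.mul_sub, pow_sub₀ _ two_ne_zero (Nat.mul_le_mul_left b hk), one_div, inv_pow, pow_mul,
        pow_mul]
    · intro j hj
      obtain ⟨a, -, rfl⟩ := Finset.mem_image.1 hj
      have := a.2
      exact Finset.mem_range.2 (Nat.mod_lt _ (by omega))
    · simp only [S, Finset.forall_mem_image, Finset.mem_univ, forall_const, hτ]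
      exact fun a => (hB a).le

/-- In a copy of `W_i`, the number of occurrences of `B` differs from `i² 2^{i³ - ik}` by at most
`k` for each of the `(i + 1)^{i²}` different blocks that make up `W_i`. -/
theorem abs_sum_occ_blockW_sub_le {i k : ℕ} (hk : k ≤ i ^ 2) (B : Fin k → ℕ) (hB : ∀ j, B j < i)
    (s : ℕ → ℕ) (p : ℕ) (hs : ∀ t < (blockW i).length, s (p + t) = (blockW i).getD t 0) :
    |∑ t ∈ Finset.range (blockW i).length, occ s B (p + t) - (i ^ 2 * 2 ^ (i * (i ^ 2 - k)) : ℕ)|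
      ≤ k * (i + 1) ^ (i ^ 2) := by
  have h := abs_sum_occ_flatMap_sub_le (lexBlocks (i + 1) (i ^ 2)) (multiplicity i (i ^ 2)) B s p hs
  rw [sum_multiplicity_mul_cyclicCount hk B hB, length_lexBlocks] at h
  exact_mod_cast h

/-! ### The portions of the sequences -/

/-- The number of positions that precede the portion `W_i^{l_i}`. -/
def start (i : ℕ) : ℕ := ∑ j ∈ Finset.range i, reps j * (blockW j).length

theorem start_succ (i : ℕ) : start (i + 1) = start i + reps i * (blockW i).length :=
  Finset.sum_range_succ _ _

theorem start_mono : Monotone start :=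
  monotone_nat_of_le_succ fun i => by rw [start_succ]; omega

theorem reps_of_le {i : ℕ} (hi : 6 ≤ i) : reps i = 2 ^ (4 * i ^ 2) := if_neg (by omega)

theorem length_blockW_pos {i : ℕ} (hi : 6 ≤ i) : 0 < (blockW i).length := by
  rw [length_blockW]; positivity

theorem start_lt_start_succ {i : ℕ} (hi : 6 ≤ i) : start i < start (i + 1) := by
  have h1 : 0 < reps i := by rw [reps_of_le hi]; positivity
  have := Nat.mul_pos h1 (length_blockW_pos hi)
  rw [start_succ]; omega

theorem exists_start_gt (t : ℕ) : ∃ i, t < start i := by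
  induction t with
  | zero => exact ⟨7, (Nat.zero_le _).trans_lt (start_lt_start_succ le_rfl)⟩
  | succ t ih =>
    obtain ⟨i, hi⟩ := ih
    have h1 : start i ≤ start (i + 6) := start_mono (by omega)
    have h2 := start_lt_start_succ (i := i + 6) (by omega)
    exact ⟨i + 6 + 1, by omega⟩

theorem exists_portion (t : ℕ) : ∃ i, 6 ≤ i ∧ start i ≤ t ∧ t < start (i + 1) := by
  classical
  have hex := exists_start_gt t
  have h1 := Nat.find_spec hex
  have h0 : start 6 = 0 := Finset.sum_eq_zero fun j hj => by
    have := Finset.mem_range.1 hj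
    rw [reps, if_pos (by omega), zero_mul]
  have h2 : 6 < Nat.find hex := by
    by_contra h
    have := start_mono (not_lt.1 h)
    omega
  obtain ⟨i, hi⟩ := Nat.exists_eq_add_of_lt h2
  have h3 : Nat.find hex = 6 + i + 1 := hi
  have h4 : ¬ t < start (6 + i) := Nat.find_min hex (by omega)
  exact ⟨6 + i, by omega, not_lt.1 h4, h3 ▸ h1⟩

theorem exists_offset {i t : ℕ} (h1 : start i ≤ t) (h2 : t < start (i + 1)) :
    ∃ r u, r < reps i ∧ u < (blockW i).length ∧ t = start i + r * (blockW i).length + u := by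
  rw [start_succ] at h2
  have hW : 0 < (blockW i).length := Nat.pos_of_ne_zero fun h => by rw [h] at h2; omega
  refine ⟨(t - start i) / (blockW i).length, (t - start i) % (blockW i).length,
    (Nat.div_lt_iff_lt_mul hW).2 (by omega), Nat.mod_lt _ hW, ?_⟩
  rw [add_assoc, mul_comm, Nat.div_add_mod]
  omega

theorem offset_lt {i r u : ℕ} (hr : r < reps i) (hu : u < (blockW i).length) :
    start i + r * (blockW i).length + u < start (i + 1) := by
  have : (r + 1) * (blockW i).length ≤ reps i * (blockW i).length := Nat.mul_le_mul_right _ hr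
  rw [start_succ]
  rw [add_mul] at this
  omega

theorem infConcat_blockPow {X : ℕ → List ℕ} (hX : ∀ i, (X i).length = (blockW i).length)
    {i r u : ℕ} (hr : r < reps i) (hu : u < (blockW i).length) :
    infConcat (fun i => blockPow (X i) (reps i)) (start i + r * (blockW i).length + u)
      = (X i).getD u 0 := by
  have h1 : (concatPrefix (fun i => blockPow (X i) (reps i)) i).length = start i := by
    simp only [length_concatPrefix, length_blockPow, hX, start]
  have h2 := offset_lt hr hu
  rw [start_succ] at h2
  rw [add_assoc, ← h1, infConcat_add, ← hX i, getD_blockPow _ hr (by rwa [hX])]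
  rw [length_blockPow, hX]
  omega

theorem seqP_eq {i t : ℕ} (h1 : start i ≤ t) (h2 : t < start (i + 1)) : seqP t = 2 ^ i := by
  have h3 : (concatPrefix
      (fun i => List.replicate (reps i * (blockW i).length) (2 ^ i)) i).length = start i := by
    simp only [length_concatPrefix, List.length_replicate, start]
  obtain ⟨v, rfl⟩ := Nat.exists_eq_add_of_le h1
  rw [start_succ] at h2
  have hv : v < reps i * (blockW i).length := by omega
  rw [seqP, ← h3, infConcat_add (by rwa [List.length_replicate]),
    List.getD_eq_getElem _ _ (by rwa [List.length_replicate]), List.getElem_replicate]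

theorem seqP_offset {i r u : ℕ} (hr : r < reps i) (hu : u < (blockW i).length) :
    seqP (start i + r * (blockW i).length + u) = 2 ^ i :=
  seqP_eq (by omega) (offset_lt hr hu)

theorem zetaDigits_offset {i r u : ℕ} (hr : r < reps i) (hu : u < (blockW i).length) :
    zetaDigits (start i + r * (blockW i).length + u) = (blockW i).getD u 0 :=
  infConcat_blockPow (fun _ => rfl) hr hu

theorem seqP_pos (t : ℕ) : 0 < seqP t := by
  obtain ⟨i, -, h1, h2⟩ := exists_portion t
  rw [seqP_eq h1 h2]
  positivity

theorem seqP_succ_le (t : ℕ) : seqP (t + 1) ≤ 2 * seqP t := by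
  obtain ⟨i, hi, h1, h2⟩ := exists_portion t
  rw [seqP_eq h1 h2]
  rcases Nat.lt_or_ge (t + 1) (start (i + 1)) with h | h
  · rw [seqP_eq (by omega) h]; omega
  · have h3 := start_lt_start_succ (i := i + 1) (by omega)
    rw [seqP_eq h (by omega), pow_succ, mul_comm]

theorem seqP_add_le (t a : ℕ) : seqP (t + a) ≤ 2 ^ a * seqP t := by
  induction a with
  | zero => simp
  | succ a ih =>
    calc seqP (t + a + 1) ≤ 2 * seqP (t + a) := seqP_succ_le _
      _ ≤ 2 * (2 ^ a * seqP t) := by gcongr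
      _ = _ := by ring

/-- A property that holds on all portions with large index holds at all large positions. -/
theorem eventually_of_portion {p : ℕ → Prop}
    (h : ∀ᶠ i in atTop, ∀ r u, r < reps i → u < (blockW i).length →
      p (start i + r * (blockW i).length + u)) : ∀ᶠ t in atTop, p t := by
  obtain ⟨i₀, hi₀⟩ := eventually_atTop.1 h
  refine eventually_atTop.2 ⟨start i₀, fun t ht => ?_⟩
  obtain ⟨i, -, h1, h2⟩ := exists_portion t
  obtain ⟨r, u, hr, hu, rfl⟩ := exists_offset h1 h2
  refine hi₀ i ?_ r u hr hu
  by_contra hlt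
  have := start_mono (show i + 1 ≤ i₀ by omega)
  omega

/-! ### Averages along the portions -/

/-- The expected number `∑_{t ≤ n} p_t^{-k}` of occurrences of a block of length `k` in base `P`, up
to the differences between neighbouring terms of `P`. -/
noncomputable def weight (k n : ℕ) : ℝ := ∑ t ∈ Finset.range n, 1 / (seqP t : ℝ) ^ k

theorem weight_mono (k : ℕ) : Monotone (weight k) :=
  monotone_nat_of_le_succ fun n => by
    rw [weight, weight, Finset.sum_range_succ]
    have : (0 : ℝ) ≤ 1 / (seqP n : ℝ) ^ k := by positivity
    linarith

theorem weight_nonneg (k n : ℕ) : 0 ≤ weight k n := Finset.sum_nonneg fun t _ => by positivity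

theorem weight_add_of_portion {k i p m : ℕ} (h1 : start i ≤ p) (h2 : p + m ≤ start (i + 1)) :
    weight k (p + m) = weight k p + m / (2 ^ i) ^ k := by
  rw [weight, Finset.sum_range_add, ← weight]
  congr 1
  rw [Finset.sum_congr rfl fun x hx => by
    have := Finset.mem_range.1 hx
    rw [seqP_eq (i := i) (t := p + x) (by omega) (by omega)]]
  simp [div_eq_mul_inv]

/-- One copy of `W_{j+1}` is short in comparison with the weight of all that precedes it; this is
where the number `l_j = 2^{4j²}` of repetitions is used. -/
theorem length_blockW_mul_le_weight {j k : ℕ} (hj : k + 7 ≤ j) :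
    ((blockW (j + 1)).length : ℝ) * 2 ^ j ≤ weight k (start (j + 1)) := by
  have h1 := weight_add_of_portion (k := k) (i := j) (p := start j)
    (m := reps j * (blockW j).length) le_rfl (start_succ j).ge
  rw [← start_succ] at h1
  have h2 := weight_nonneg k (start j)
  refine le_trans ?_ (le_of_le_of_eq (le_add_of_nonneg_left h2) h1.symm)
  rw [le_div_iff₀ (by positivity), length_blockW, length_blockW, reps_of_le (by omega)]
  norm_cast
  have h3 : (j + 1) ^ 2 ≤ 2 ^ 2 * j ^ 2 := by nlinarith
  -- The surplus `4j² - ((j + 1)³ - j³)` in the exponent exceeds `j * k + j` for these `j`.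
  have h4 : 2 + (j + 1) ^ 3 + j + j * k ≤ 4 * j ^ 2 + j ^ 3 := by nlinarith
  calc (j + 1) ^ 2 * 2 ^ (j + 1) ^ 3 * 2 ^ j * (2 ^ j) ^ k
      ≤ 2 ^ 2 * j ^ 2 * 2 ^ (j + 1) ^ 3 * 2 ^ j * (2 ^ j) ^ k := by gcongr
    _ = j ^ 2 * 2 ^ (2 + (j + 1) ^ 3 + j + j * k) := by
        rw [pow_add, pow_add, pow_add, pow_mul]; ring
    _ ≤ j ^ 2 * 2 ^ (4 * j ^ 2 + j ^ 3) := by gcongr; norm_num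
    _ = 2 ^ (4 * j ^ 2) * (j ^ 2 * 2 ^ j ^ 3) := by rw [pow_add]; ring

theorem tendsto_weight_atTop (k : ℕ) : Tendsto (weight k) atTop atTop := by
  refine tendsto_atTop_atTop_of_monotone (weight_mono k) fun b => ?_
  obtain ⟨j, hj⟩ := ((tendsto_pow_atTop_atTop_of_one_lt
    (one_lt_two : (1 : ℝ) < 2)).eventually_ge_atTop b |>.and (eventually_ge_atTop (k + 7))).exists
  have h1 : (1 : ℝ) ≤ (blockW (j + 1)).length := by
    exact_mod_cast length_blockW_pos (by omega)
  have h2 := length_blockW_mul_le_weight hj.2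
  exact ⟨_, hj.1.trans ((le_mul_of_one_le_left (by positivity) h1).trans h2)⟩

/-- If the sum of a bounded function over each copy of `W_i` is, up to a small relative error, `L`
times the weight of that copy, then `L` is the limit of its averages relative to the weight. -/
theorem tendsto_sum_div_weight {f : ℕ → ℝ} (hf0 : ∀ t, 0 ≤ f t) (hf1 : ∀ t, f t ≤ 1) (k : ℕ)
    (L : ℝ) {δ : ℕ → ℝ} (hδ : Tendsto δ atTop (𝓝 0))
    (h : ∀ᶠ i in atTop, ∀ r < reps i,
      |∑ u ∈ Finset.range (blockW i).length, f (start i + r * (blockW i).length + u)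
        - L * ((blockW i).length / (2 ^ i) ^ k)| ≤ δ i * ((blockW i).length / (2 ^ i) ^ k)) :
    Tendsto (fun n => (∑ t ∈ Finset.range n, f t) / weight k n) atTop (𝓝 L) := by
  set D : ℕ → ℝ := fun n => ∑ t ∈ Finset.range n, f t - L * weight k n with hD
  -- At a general position, `D` changes by at most `1 + |L|` per step.
  have hDstep : ∀ p m, |D (p + m) - D p| ≤ (1 + |L|) * m := by
    intro p m
    have h1 : ∀ n, |D (n + 1) - D n| ≤ 1 + |L| := by
      intro n
      have h2 : D (n + 1) - D n = f n - L * (1 / (seqP n : ℝ) ^ k) := by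
        simp only [hD, weight, Finset.sum_range_succ]; ring
      have h3 : (1 : ℝ) ≤ (seqP n : ℝ) ^ k := one_le_pow₀ (by exact_mod_cast seqP_pos n)
      rw [h2]
      refine (abs_sub _ _).trans (add_le_add ?_ ?_)
      · rw [abs_of_nonneg (hf0 n)]; exact hf1 n
      · rw [abs_mul, abs_of_nonneg (by positivity : (0 : ℝ) ≤ 1 / (seqP n : ℝ) ^ k)]
        exact mul_le_of_le_one_right (abs_nonneg _) (div_le_one_of_le₀ h3 (by positivity))
    induction m with
    | zero => simp
    | succ m ih =>
      have := abs_sub_le (D (p + (m + 1))) (D (p + m)) (D p)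
      have := h1 (p + m)
      push_cast
      rw [← add_assoc] at *
      linarith
  have hW := tendsto_weight_atTop k
  rw [Metric.tendsto_nhds]
  intro ε hε
  set η := ε / 4 with hη
  have hη0 : 0 < η := by positivity
  obtain ⟨i₀, hi₀⟩ := eventually_atTop.1 ((h.and (hδ.eventually_lt_const hη0)).and
    ((tendsto_pow_atTop_atTop_of_one_lt (one_lt_two : (1 : ℝ) < 2)).eventually_ge_atTop
      ((1 + |L|) / η)))
  set j₀ := max i₀ (k + 7) with hj₀
  -- Whole copies of `W_i` contribute a small relative error.
  have hcopies : ∀ i, j₀ ≤ i → ∀ r ≤ reps i,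
      |D (start i + r * (blockW i).length) - D (start i)|
        ≤ η * (weight k (start i + r * (blockW i).length) - weight k (start i)) := by
    intro i hi r
    induction r with
    | zero => simp
    | succ r ih =>
      intro hr
      have h1 := ih (by omega)
      obtain ⟨⟨h2, h3⟩, -⟩ := hi₀ i (by omega)
      have h2 := h2 r hr
      have h4 : (r + 1) * (blockW i).length ≤ reps i * (blockW i).length :=
        Nat.mul_le_mul_right _ hr
      rw [add_mul, one_mul] at h4
      have h5 := weight_add_of_portion (k := k) (i := i) (p := start i + r * (blockW i).length)
        (m := (blockW i).length) (by omega) (by rw [start_succ]; omega)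
      have h6 : D (start i + r * (blockW i).length + (blockW i).length)
            - D (start i + r * (blockW i).length)
          = ∑ u ∈ Finset.range (blockW i).length, f (start i + r * (blockW i).length + u)
            - L * ((blockW i).length / (2 ^ i) ^ k) := by
        simp only [hD, Finset.sum_range_add, h5]; ring
      rw [← h6] at h2
      have h7 : δ i * ((blockW i).length / (2 ^ i) ^ k : ℝ)
          ≤ η * ((blockW i).length / (2 ^ i) ^ k) := by gcongr
      rw [add_mul, one_mul, ← add_assoc, h5]
      have := abs_sub_le (D (start i + r * (blockW i).length + (blockW i).length))
        (D (start i + r * (blockW i).length)) (D (start i))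
      linarith
  have hstart : ∀ i, j₀ ≤ i →
      |D (start i) - D (start j₀)| ≤ η * (weight k (start i) - weight k (start j₀)) := by
    intro i hi
    induction i, hi using Nat.le_induction with
    | base => simp
    | succ i hi ih =>
      have h1 := hcopies i hi (reps i) le_rfl
      rw [← start_succ] at h1
      have := abs_sub_le (D (start (i + 1))) (D (start i)) (D (start j₀))
      linarith
  filter_upwards [eventually_ge_atTop (start (j₀ + 1)), hW.eventually_gt_atTop 0,
    hW.eventually_ge_atTop (|D (start j₀)| / η)] with n hn hpos hbig
  obtain ⟨i, -, hi1, hi2⟩ := exists_portion n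
  have hi : j₀ + 1 ≤ i := by
    by_contra hlt
    have := start_mono (show i + 1 ≤ j₀ + 1 by omega)
    omega
  obtain ⟨r, u, hr, hu, hnu⟩ := exists_offset hi1 hi2
  have h1 := hcopies i (by omega) r hr.le
  have h2 := hstart i (by omega)
  have h3 := hDstep (start i + r * (blockW i).length) u
  rw [← hnu] at h3
  have h4 : weight k (start i + r * (blockW i).length) ≤ weight k n := weight_mono k (by omega)
  have h5 : (1 + |L|) * u ≤ η * weight k n := by
    obtain ⟨j, rfl⟩ : ∃ j, i = j + 1 := ⟨i - 1, by omega⟩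
    have h6 := length_blockW_mul_le_weight (j := j) (k := k) (by omega)
    have h7 := (hi₀ j (by omega)).2
    rw [div_le_iff₀ hη0] at h7
    have h8 : (u : ℝ) ≤ (blockW (j + 1)).length := by exact_mod_cast hu.le
    calc (1 + |L|) * u ≤ (2 ^ j * η) * (blockW (j + 1)).length := by gcongr
      _ = η * ((blockW (j + 1)).length * 2 ^ j) := by ring
      _ ≤ η * weight k n := by
        gcongr
        exact h6.trans (weight_mono k hi1)
  have h6 : |D (start j₀)| ≤ η * weight k n := by
    rw [div_le_iff₀ hη0] at hbig; linarith
  have h7 : |D n| ≤ 3 * η * weight k n := by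
    have a1 := abs_sub_le (D n) (D (start i + r * (blockW i).length)) 0
    have a2 := abs_sub_le (D (start i + r * (blockW i).length)) (D (start i)) 0
    have a3 := abs_sub_le (D (start i)) (D (start j₀)) 0
    have a4 := weight_nonneg k (start j₀)
    have a5 : 0 ≤ η * weight k (start j₀) := by positivity
    have a6 := mul_le_mul_of_nonneg_left h4 hη0.le
    simp only [sub_zero] at a1 a2 a3
    linarith
  have h8 : (∑ t ∈ Finset.range n, f t) / weight k n - L = D n / weight k n := by
    simp only [hD]; field_simp
  rw [Real.dist_eq, h8, abs_div, abs_of_pos hpos, div_lt_iff₀ hpos]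
  have : 3 * η * weight k n < ε * weight k n := by
    gcongr; rw [hη]; linarith
  linarith

/-! ### Cantor series with given digits -/

theorem hasSum_sub_one_div_prodQ {Q : ℕ → ℕ} (hQ : IsBasic Q) :
    HasSum (fun n => ((Q n : ℝ) - 1) / prodQ Q (n + 1)) 1 := by
  have hterm : ∀ n, ((Q n : ℝ) - 1) / prodQ Q (n + 1) = 1 / prodQ Q n - 1 / prodQ Q (n + 1) := by
    intro n
    have h1 := prodQ_pos hQ n
    have h2 : (0 : ℝ) < Q n := by have := hQ n; positivity
    rw [prodQ_succ]
    field_simp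
  have h0 : ∀ n, 0 ≤ ((Q n : ℝ) - 1) / prodQ Q (n + 1) := fun n => by
    have h2 : (2 : ℝ) ≤ Q n := by exact_mod_cast hQ n
    exact div_nonneg (by linarith) (prodQ_pos hQ _).le
  rw [hasSum_iff_tendsto_nat_of_nonneg h0]
  simp only [hterm, Finset.sum_range_sub' fun n => 1 / prodQ Q n]
  have hlim : Tendsto (fun n => 1 / prodQ Q n) atTop (𝓝 0) := by
    refine squeeze_zero (fun n => (one_div_pos.2 (prodQ_pos hQ n)).le) (fun n => ?_)
      (tendsto_pow_atTop_nhds_zero_of_lt_one (r := (1 / 2 : ℝ)) (by norm_num) (by norm_num))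
    rw [div_pow, one_pow]
    exact one_div_le_one_div_of_le (by positivity) (two_pow_le_prodQ hQ n)
  simpa [prodQ] using hlim.const_sub (1 / prodQ Q 0)

/-- A series whose digits are admissible is the expansion of its sum. -/
theorem isCantorExpansion_tsum {Q : ℕ → ℕ} (hQ : IsBasic Q) {E : ℕ → ℕ} (hlt : ∀ n, E n < Q n)
    (hfreq : ∃ᶠ n in atTop, E n ≠ Q n - 1) :
    IsCantorExpansion Q (∑' n, (E n : ℝ) / prodQ Q (n + 1)) E := by
  have h1 := hasSum_sub_one_div_prodQ hQ
  have h0 : ∀ n, 0 ≤ (E n : ℝ) / prodQ Q (n + 1) := fun n =>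
    div_nonneg (Nat.cast_nonneg _) (prodQ_pos hQ _).le
  have hle : ∀ n, (E n : ℝ) / prodQ Q (n + 1) ≤ ((Q n : ℝ) - 1) / prodQ Q (n + 1) := fun n => by
    have h2 : (E n : ℝ) + 1 ≤ Q n := by exact_mod_cast hlt n
    have := prodQ_pos hQ (n + 1)
    gcongr
    linarith
  have hsum : Summable fun n => (E n : ℝ) / prodQ Q (n + 1) :=
    Summable.of_nonneg_of_le h0 hle h1.summable
  obtain ⟨n, hn⟩ := hfreq.exists
  have hltone : ∑' n, (E n : ℝ) / prodQ Q (n + 1) < 1 := by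
    rw [← h1.tsum_eq]
    refine Summable.tsum_lt_tsum hle ?_ hsum h1.summable (i := n)
    have h2 : (E n : ℝ) + 1 < Q n := by
      have := hlt n
      exact_mod_cast (show E n + 1 < Q n by omega)
    have := prodQ_pos hQ (n + 1)
    gcongr
    linarith
  refine ⟨hlt, hfreq, ?_⟩
  rw [Int.fract_eq_self.2 ⟨tsum_nonneg h0, hltone⟩]
  exact hsum.hasSum

theorem isCantorExpansion_digits {Q : ℕ → ℕ} (hQ : IsBasic Q) (x : ℝ) :
    IsCantorExpansion Q x (digits Q x) :=
  Classical.epsilon_spec (existsUnique_isCantorExpansion hQ x).exists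

theorem digits_tsum {Q : ℕ → ℕ} (hQ : IsBasic Q) {E : ℕ → ℕ} (hlt : ∀ n, E n < Q n)
    (hfreq : ∃ᶠ n in atTop, E n ≠ Q n - 1) :
    digits Q (∑' n, (E n : ℝ) / prodQ Q (n + 1)) = E :=
  (existsUnique_isCantorExpansion hQ _).unique (isCantorExpansion_digits hQ _)
    (isCantorExpansion_tsum hQ hlt hfreq)

theorem digits_div_le_shiftT {Q : ℕ → ℕ} (hQ : IsBasic Q) (x : ℝ) (n : ℕ) :
    (digits Q x n : ℝ) / Q n ≤ shiftT Q n x ∧ shiftT Q n x < (digits Q x n + 1) / Q n := by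
  have h1 := (isCantorExpansion_digits hQ x).digit_eq hQ n
  have h2 : (0 : ℝ) < Q n := by have := hQ n; positivity
  have h3 : 0 ≤ shiftT Q n x := Int.fract_nonneg _
  rw [eq_comm, ← shiftT, Nat.floor_eq_iff (mul_nonneg h2.le h3)] at h1
  rw [div_le_iff₀ h2, lt_div_iff₀ h2, mul_comm]
  exact h1

/-! ### The portionings -/

/-- The number of elements of each of the `i` classes. -/
def classSize (i : ℕ) : ℕ := i * 2 ^ (i ^ 3) - i ^ 2 * 2 ^ (i ^ 3 - i)

theorem two_pow_cube (i : ℕ) : 2 ^ (i ^ 3) = 2 ^ i * 2 ^ (i ^ 3 - i) := by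
  rw [← pow_add]
  congr 1
  have := Nat.le_self_pow (n := 3) (by norm_num) i
  omega

theorem classSize_eq (i : ℕ) : classSize i = i * (2 ^ i - i) * 2 ^ (i ^ 3 - i) := by
  rw [classSize, two_pow_cube i, mul_assoc, Nat.sub_mul, Nat.mul_sub]
  congr 1
  ring

theorem count_self_blockW (i : ℕ) : (blockW i).count i = i * classSize i := by
  have h1 := count_self_blockV i (i ^ 2)
  have h2 : (i : ℕ) ≤ 2 ^ i := Nat.lt_two_pow_self.le
  have h3 : (2 : ℚ) ^ (i * i ^ 2) = 2 ^ i * 2 ^ (i ^ 3 - i) := by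
    rw [show i * i ^ 2 = i ^ 3 by ring]
    exact_mod_cast two_pow_cube i
  rw [← Nat.cast_inj (R := ℚ), blockW, h1, classSize_eq i, h3]
  push_cast [Nat.cast_sub h2]
  field_simp

theorem card_filter_getD_blockW (i : ℕ) :
    {t ∈ Finset.range (blockW i).length | (blockW i).getD t 0 = i}.card = i * classSize i := by
  rw [card_filter_getD_eq_count, count_self_blockW i]

theorem exists_isGrouping : ∃ g : ℕ → ℕ → ℕ, IsGrouping g := by
  have key : ∀ i, ∃ γ : ℕ → ℕ,
      (∀ t ∈ {t ∈ Finset.range (blockW i).length | (blockW i).getD t 0 = i},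
        γ t ∈ Finset.Icc 1 i) ∧
      ∀ c ∈ Finset.Icc 1 i,
        {t ∈ {t ∈ Finset.range (blockW i).length | (blockW i).getD t 0 = i} | γ t = c}.card
          = classSize i := by
    intro i
    have hcard := card_filter_getD_blockW i
    set A := {t ∈ Finset.range (blockW i).length | (blockW i).getD t 0 = i} with hA
    let e : A ≃ Fin i × Fin (classSize i) := Fintype.equivOfCardEq (by simp [hcard])
    obtain ⟨γ, hγ⟩ : ∃ γ : ℕ → ℕ, ∀ t (h : t ∈ A), γ t = (e ⟨t, h⟩).1 + 1 :=
      ⟨fun t => if h : t ∈ A then (e ⟨t, h⟩).1 + 1 else 0, fun t h => dif_pos h⟩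
    refine ⟨γ, fun t ht => ?_, fun c hc => ?_⟩
    · rw [hγ t ht, Finset.mem_Icc]
      have := (e ⟨t, ht⟩).1.2
      omega
    · obtain ⟨hc1, hc2⟩ := Finset.mem_Icc.1 hc
      refine Eq.trans (Eq.symm ?_) (Finset.card_fin (classSize i))
      refine Finset.card_bij (fun a _ => (e.symm (⟨c - 1, by omega⟩, a) : ℕ)) (fun a _ => ?_)
        (fun a _ b _ hab => ?_) fun t ht => ?_
      · rw [Finset.mem_filter]
        refine ⟨Subtype.coe_prop _, ?_⟩
        rw [hγ _ (Subtype.coe_prop _)]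
        simp only [Subtype.coe_eta, Equiv.apply_symm_apply]
        omega
      · simpa using hab
      · obtain ⟨htA, htc⟩ := Finset.mem_filter.1 ht
        rw [hγ t htA] at htc
        refine ⟨(e ⟨t, htA⟩).2, Finset.mem_univ _, ?_⟩
        have : ((⟨c - 1, by omega⟩, (e ⟨t, htA⟩).2) : Fin i × Fin (classSize i)) = e ⟨t, htA⟩ :=
          Prod.ext (Fin.ext (by simp only; omega)) rfl
        rw [this, Equiv.symm_apply_apply]
  choose g hg using key
  refine ⟨g, fun i _ t ht hti => (hg i).1 t (Finset.mem_filter.2 ⟨Finset.mem_range.2 ht, hti⟩),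
    fun i _ c hc => ?_⟩
  rw [← Finset.filter_filter]
  exact (hg i).2 c hc

theorem classSize_pos {i : ℕ} (hi : 1 ≤ i) : 0 < classSize i := by
  have : i < 2 ^ i := Nat.lt_two_pow_self
  rw [classSize_eq i]
  have : 0 < 2 ^ i - i := by omega
  positivity

/-- The positions of `W_i` with a digit less than `i` are few. -/
theorem length_blockW_eq (i : ℕ) :
    (blockW i).length = i * classSize i + i ^ 3 * 2 ^ (i ^ 3 - i) := by
  have : i ≤ 2 ^ i := Nat.lt_two_pow_self.le
  rw [length_blockW, classSize_eq i, two_pow_cube i]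
  obtain ⟨d, hd⟩ := Nat.exists_eq_add_of_le this
  rw [hd, Nat.add_sub_cancel_left]
  ring

/-! ### The terms of `Q` and the digits -/

theorem length_blockQ (g : ℕ → ℕ → ℕ) (i : ℕ) : (blockQ g i).length = (blockW i).length := by
  simp [blockQ]

theorem seqQ_offset (g : ℕ → ℕ → ℕ) {i r u : ℕ} (hr : r < reps i) (hu : u < (blockW i).length) :
    seqQ g (start i + r * (blockW i).length + u)
      = if (blockW i).getD u 0 < i then i
        else if g i u = 1 then i ^ 3 else i ^ 2 / (g i u - 1) := by
  rw [seqQ, infConcat_blockPow (length_blockQ g) hr hu, List.getD_eq_getElem _ _ hu,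
    List.getD_eq_getElem _ _ (by rwa [length_blockQ])]
  simp only [blockQ, List.getElem_mapIdx]

/-- `⌊i² / m⌋ > i` for `m < i`, so the digit `i` is admissible at every position of its classes. -/
theorem lt_sq_div {i m : ℕ} (hm : 1 ≤ m) (hmi : m < i) : i + 1 ≤ i ^ 2 / m := by
  rw [Nat.le_div_iff_mul_le hm]
  obtain ⟨d, rfl⟩ := Nat.exists_eq_add_of_lt hmi
  nlinarith

theorem seqQ_bounds {g : ℕ → ℕ → ℕ} (hg : IsGrouping g) {i r u : ℕ} (hi : 6 ≤ i) (hr : r < reps i)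
    (hu : u < (blockW i).length) :
    i ≤ seqQ g (start i + r * (blockW i).length + u) ∧
      seqQ g (start i + r * (blockW i).length + u) ≤ i ^ 3 ∧
      zetaDigits (start i + r * (blockW i).length + u)
        < seqQ g (start i + r * (blockW i).length + u) := by
  rw [seqQ_offset g hr hu, zetaDigits_offset hr hu]
  have h1 := getD_blockW_le hu
  have h2 : i ≤ i ^ 3 := Nat.le_self_pow (by norm_num) i
  have h3 : i ^ 2 ≤ i ^ 3 := Nat.pow_le_pow_right (by omega) (by norm_num)
  have h5 : i < i ^ 3 := by nlinarith
  split_ifs with hlt hc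
  · exact ⟨le_rfl, h2, hlt⟩
  · exact ⟨h2, le_rfl, by omega⟩
  · have h4 := Finset.mem_Icc.1 (hg.mem i hi u hu (by omega))
    have h6 := lt_sq_div (i := i) (m := g i u - 1) (by omega) (by omega)
    exact ⟨by omega, (Nat.div_le_self _ _).trans h3, by omega⟩

theorem exists_seqQ_bounds {g : ℕ → ℕ → ℕ} (hg : IsGrouping g) (t : ℕ) :
    6 ≤ seqQ g t ∧ zetaDigits t < seqQ g t := by
  obtain ⟨i, hi, h1, h2⟩ := exists_portion t
  obtain ⟨r, u, hr, hu, rfl⟩ := exists_offset h1 h2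
  have := seqQ_bounds hg hi hr hu
  omega

theorem isBasic_seqQ {g : ℕ → ℕ → ℕ} (hg : IsGrouping g) : IsBasic (seqQ g) := fun n => by
  have := exists_seqQ_bounds hg n
  omega

theorem isBasic_seqP : IsBasic seqP := fun n => by
  obtain ⟨i, hi, h1, h2⟩ := exists_portion n
  rw [seqP_eq h1 h2]
  exact Nat.le_self_pow (by omega) 2

theorem zetaDigits_lt_seqP (n : ℕ) : zetaDigits n + 1 < seqP n := by
  obtain ⟨i, hi, h1, h2⟩ := exists_portion n
  obtain ⟨r, u, hr, hu, rfl⟩ := exists_offset h1 h2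
  have h3 := getD_blockW_le hu
  have h4 : i + 1 < 2 ^ i := by
    obtain ⟨d, rfl⟩ := Nat.exists_eq_add_of_le hi
    have : d < 2 ^ d := Nat.lt_two_pow_self
    rw [pow_add]
    omega
  rw [zetaDigits_offset hr hu, seqP_eq h1 h2]
  omega

theorem digits_zeta : digits seqP zeta = zetaDigits :=
  digits_tsum isBasic_seqP (fun n => by have := zetaDigits_lt_seqP n; omega)
    (Frequently.of_forall fun n => by have := zetaDigits_lt_seqP n; omega)

theorem frequently_zetaDigits_ne {g : ℕ → ℕ → ℕ} (hg : IsGrouping g) :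
    ∃ᶠ n in atTop, zetaDigits n ≠ seqQ g n - 1 := by
  refine frequently_atTop.2 fun N => ?_
  obtain ⟨i', hi'⟩ := exists_start_gt N
  have h1 : start i' ≤ start (i' + 6) := start_mono (by omega)
  set i := i' + 6 with hi
  -- The positions of class 1 have the digit `i`, and there the term of `Q` is `i³`.
  have h2 := hg.card i (by omega) 1 (by simp; omega)
  rw [← classSize] at h2
  obtain ⟨u, hu⟩ := Finset.card_pos.1 (h2.symm ▸ classSize_pos (i := i) (by omega))
  simp only [Finset.mem_filter, Finset.mem_range] at hu
  obtain ⟨hu, hui, hug⟩ := hu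
  have h3 : 0 < reps i := by rw [reps_of_le (by omega)]; positivity
  refine ⟨start i + 0 * (blockW i).length + u, by omega, ?_⟩
  rw [seqQ_offset g h3 hu, zetaDigits_offset h3 hu, hui, if_neg (lt_irrefl _), if_pos hug]
  have h4 : 6 ≤ i := by omega
  have : i + 1 < i ^ 3 := by
    calc i + 1 < i * 6 := by omega
      _ ≤ i * i ^ 2 := by gcongr; nlinarith
      _ = i ^ 3 := by ring
  omega

/-- Every digit of `ζ` is at most `qₙ - 1`, so that `ψ_{P,Q}` does not change the digits of `ζ`. -/
theorem digits_psi {g : ℕ → ℕ → ℕ} (hg : IsGrouping g) :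
    digits (seqQ g) (psi seqP (seqQ g) zeta) = zetaDigits := by
  have h : psi seqP (seqQ g) zeta = ∑' n, (zetaDigits n : ℝ) / prodQ (seqQ g) (n + 1) := by
    unfold psi
    refine tsum_congr fun n => ?_
    have := exists_seqQ_bounds hg n
    rw [digits_zeta, min_eq_left (by omega)]
  rw [h]
  exact digits_tsum (isBasic_seqQ hg) (fun n => (exists_seqQ_bounds hg n).2)
    (frequently_zetaDigits_ne hg)

theorem infiniteInLimit_seqQ {g : ℕ → ℕ → ℕ} (hg : IsGrouping g) : InfiniteInLimit (seqQ g) := by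
  refine tendsto_atTop.2 fun b => eventually_of_portion ?_
  filter_upwards [eventually_ge_atTop (max 6 b)] with i hi r u hr hu
  have := (seqQ_bounds hg (by omega) hr hu).1
  omega

/-- The terms of `Q` are at most `i³` where those of `P` are `2^i`. -/
theorem eventually_mul_seqQ_le_seqP {g : ℕ → ℕ → ℕ} (hg : IsGrouping g) (C : ℕ) :
    ∀ᶠ t in atTop, C * seqQ g t ≤ seqP t := by
  refine eventually_of_portion ?_
  have h1 : ∀ᶠ i : ℕ in atTop, C * i ^ 3 ≤ 2 ^ i := by
    have h2 := isLittleO_pow_const_const_pow_of_one_lt (R := ℝ) 3 (one_lt_two : (1 : ℝ) < 2)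
    filter_upwards [h2.def (c := 1 / (C + 1)) (by positivity)] with i hi
    simp only [norm_pow, Real.norm_natCast, Real.norm_ofNat] at hi
    rw [one_div, inv_mul_eq_div, le_div_iff₀ (by positivity)] at hi
    have : (C * i ^ 3 : ℝ) ≤ 2 ^ i := by nlinarith [pow_nonneg (Nat.cast_nonneg (α := ℝ) i) 3]
    exact_mod_cast this
  filter_upwards [h1, eventually_ge_atTop 6] with i hi h6 r u hr hu
  rw [seqP_offset hr hu]
  exact (Nat.mul_le_mul_left C (seqQ_bounds hg h6 hr hu).2.1).trans hi

/-! ### Ratio normality -/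

/-- The number of different blocks in `W_i` is negligible in comparison with the number of
occurrences of a fixed block in `W_i`. -/
theorem succ_pow_sq_mul_le {i k : ℕ} (h5 : 5 ≤ i) (hk : k < i) :
    (i + 1) ^ (i ^ 2) * 2 ^ i ≤ i ^ 2 * 2 ^ (i * (i ^ 2 - k)) := by
  have h1 : i + 1 ≤ 2 ^ (i - 2) := by
    obtain ⟨d, rfl⟩ := Nat.exists_eq_add_of_le' h5
    have : d < 2 ^ d := Nat.lt_two_pow_self
    rw [show d + 5 - 2 = d + 3 by omega, pow_add]
    omega
  have h2 : (i - 2) * i ^ 2 + i ≤ i * (i ^ 2 - k) := by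
    obtain ⟨d, rfl⟩ := Nat.exists_eq_add_of_le' h5
    have h3 : k ≤ (d + 5) ^ 2 := by nlinarith
    obtain ⟨e, he⟩ := Nat.exists_eq_add_of_le h3
    rw [show d + 5 - 2 = d + 3 by omega, he, Nat.add_sub_cancel_left]
    nlinarith
  calc (i + 1) ^ (i ^ 2) * 2 ^ i ≤ (2 ^ (i - 2)) ^ (i ^ 2) * 2 ^ i := by gcongr
    _ = 2 ^ ((i - 2) * i ^ 2 + i) := by rw [← pow_mul, pow_add]
    _ ≤ 2 ^ (i * (i ^ 2 - k)) := by gcongr; norm_num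
    _ ≤ i ^ 2 * 2 ^ (i * (i ^ 2 - k)) := Nat.le_mul_of_pos_left _ (by positivity)

/-- Every block of length `k` occurs in the digits of `ζ` with frequency `p_t^{-k}`: the
Altomare–Mance number is `P`-normal. -/
theorem tendsto_sum_occ_div_weight {k : ℕ} (B : Fin k → ℕ) :
    Tendsto (fun n => (∑ t ∈ Finset.range n, occ zetaDigits B t) / weight k n) atTop (𝓝 1) := by
  have hδ : Tendsto (fun i : ℕ => (k : ℝ) * (1 / 2) ^ i) atTop (𝓝 0) := by
    simpa using (tendsto_pow_atTop_nhds_zero_of_lt_one (r := (1 / 2 : ℝ)) (by norm_num)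
      (by norm_num)).const_mul (k : ℝ)
  refine tendsto_sum_div_weight (occ_nonneg _ B) (occ_le_one _ B) k 1 hδ ?_
  filter_upwards [eventually_ge_atTop 5, eventually_gt_atTop k,
    eventually_gt_atTop (Finset.univ.sup B)] with i h5 hk hB r hr
  have hki : k ≤ i ^ 2 := by nlinarith
  have h1 := abs_sum_occ_blockW_sub_le hki B
    (fun j => (Finset.le_sup (f := B) (Finset.mem_univ j)).trans_lt hB) zetaDigits
    (start i + r * (blockW i).length) fun t ht => zetaDigits_offset hr ht
  have h2 : ((blockW i).length / (2 ^ i) ^ k : ℝ) = (i ^ 2 * 2 ^ (i * (i ^ 2 - k)) : ℕ) := by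
    have h3 : i ^ 3 = i * (i ^ 2 - k) + i * k := by
      rw [← mul_add, Nat.sub_add_cancel hki]; ring
    rw [length_blockW, h3, div_eq_iff (by positivity)]
    push_cast
    rw [pow_add, ← pow_mul]
    ring
  rw [h2, one_mul]
  refine h1.trans ?_
  have h4 : ((i + 1 : ℝ) ^ (i ^ 2) * 2 ^ i) ≤ (i ^ 2 * 2 ^ (i * (i ^ 2 - k)) : ℕ) := by
    exact_mod_cast succ_pow_sq_mul_le h5 hk
  rw [mul_assoc]
  gcongr
  rw [one_div, inv_pow, inv_mul_eq_div, le_div_iff₀ (by positivity)]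
  exact h4

theorem blockCount_psi {g : ℕ → ℕ → ℕ} (hg : IsGrouping g) {k : ℕ} (B : Fin k → ℕ) (n : ℕ) :
    (blockCount (seqQ g) B (psi seqP (seqQ g) zeta) n : ℝ)
      = ∑ t ∈ Finset.range n, occ zetaDigits B t := by
  rw [blockCount, digits_psi hg, Finset.card_filter]
  push_cast
  rfl

theorem psi_mem_ratioNormalNumbers {g : ℕ → ℕ → ℕ} (hg : IsGrouping g) :
    psi seqP (seqQ g) zeta ∈ ratioNormalNumbers (seqQ g) := by
  intro k _ B₁ B₂
  have h := (tendsto_sum_occ_div_weight B₁).div (tendsto_sum_occ_div_weight B₂) one_ne_zero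
  rw [div_one] at h
  refine h.congr' ?_
  filter_upwards [(tendsto_weight_atTop k).eventually_gt_atTop 0] with n hn
  rw [blockCount_psi hg, blockCount_psi hg, Pi.div_apply, div_div_div_cancel_right₀ hn.ne']

/-! ### Full divergence and the failure of normality -/

theorem fullyDivergent_seqQ {g : ℕ → ℕ → ℕ} (hg : IsGrouping g) : FullyDivergent (seqQ g) := by
  intro k _
  obtain ⟨N, hN⟩ := eventually_atTop.1 (eventually_mul_seqQ_le_seqP hg (2 ^ k))
  have hpos : ∀ n, (0 : ℝ) < seqQ g n := fun n => by
    have := isBasic_seqQ hg n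
    positivity
  have hterm : ∀ j, N ≤ j →
      1 / (seqP j : ℝ) ^ k ≤ 1 / ∏ i ∈ Finset.range k, (seqQ g (j + i) : ℝ) := by
    intro j hj
    refine one_div_le_one_div_of_le (Finset.prod_pos fun i _ => hpos _) ?_
    calc ∏ i ∈ Finset.range k, (seqQ g (j + i) : ℝ) ≤ ∏ _i ∈ Finset.range k, (seqP j : ℝ) := by
          refine Finset.prod_le_prod (fun i _ => (hpos _).le) fun i hi => ?_
          have h1 := hN (j + i) (by omega)
          have h2 : 2 ^ i * seqP j ≤ 2 ^ k * seqP j := by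
            have := Finset.mem_range.1 hi
            gcongr
            norm_num
          exact_mod_cast Nat.le_of_mul_le_mul_left ((h1.trans (seqP_add_le j i)).trans h2)
            (by positivity)
      _ = (seqP j : ℝ) ^ k := by rw [Finset.prod_const, Finset.card_range]
  refine tendsto_atTop_mono' _ ?_ (tendsto_atTop_add_const_right _ (-weight k N)
    (tendsto_weight_atTop k))
  filter_upwards [eventually_ge_atTop N] with n hn
  obtain ⟨m, rfl⟩ := Nat.exists_eq_add_of_le hn
  rw [weight, Finset.sum_range_add, ← weight, expCount, Finset.sum_range_add]
  have h1 : 0 ≤ ∑ j ∈ Finset.range N, 1 / ∏ i ∈ Finset.range k, (seqQ g (j + i) : ℝ) :=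
    Finset.sum_nonneg fun j _ =>
      (one_div_pos.2 (Finset.prod_pos fun i _ => hpos _)).le
  have h2 := Finset.sum_le_sum fun x (_ : x ∈ Finset.range m) => hterm (N + x) (by omega)
  linarith

/-- The terms of `Q` are much smaller than those of `P`, so that `N_n(B)`, which is asymptotic to
`∑ p_t^{-1}` for a block of length one, is too small for normality with respect to `Q`. -/
theorem psi_notMem_normalNumbers {g : ℕ → ℕ → ℕ} (hg : IsGrouping g) :
    psi seqP (seqQ g) zeta ∉ normalNumbers (seqQ g) := by
  intro hmem
  have h1 := hmem 1 le_rfl fun _ => 0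
  simp only [blockCount_psi hg] at h1
  have h2 := tendsto_sum_occ_div_weight fun _ : Fin 1 => 0
  obtain ⟨N, hN⟩ := eventually_atTop.1 (eventually_mul_seqQ_le_seqP hg 2)
  have hpos : ∀ n, (0 : ℝ) < seqQ g n := fun n => by
    have := isBasic_seqQ hg n
    positivity
  have hexp : ∀ m, 2 * weight 1 (N + m) - 2 * weight 1 N ≤ expCount (seqQ g) 1 (N + m) := by
    intro m
    rw [weight, Finset.sum_range_add, ← weight, expCount, Finset.sum_range_add]
    simp only [Finset.prod_range_one, add_zero, pow_one]
    have h3 : 0 ≤ ∑ j ∈ Finset.range N, 1 / (seqQ g j : ℝ) :=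
      Finset.sum_nonneg fun j _ => (one_div_pos.2 (hpos _)).le
    have h4 : 2 * ∑ x ∈ Finset.range m, 1 / (seqP (N + x) : ℝ)
        ≤ ∑ x ∈ Finset.range m, 1 / (seqQ g (N + x) : ℝ) := by
      rw [Finset.mul_sum]
      refine Finset.sum_le_sum fun x _ => ?_
      have h5 : (2 * seqQ g (N + x) : ℝ) ≤ seqP (N + x) := by exact_mod_cast hN (N + x) (by omega)
      have h6 := hpos (N + x)
      rw [mul_one_div, div_le_div_iff₀ (by linarith) h6]
      linarith
    linarith
  have hW := tendsto_weight_atTop 1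
  have hE := fullyDivergent_seqQ hg 1 le_rfl
  -- Far out, `3/4 (2w - 2w₀) ≤ 3/4 Q_n^{(1)} < N_n < 5/4 w` with `w = weight 1 n` and
  -- `w₀ = weight 1 N`, which is impossible once `w > 6 w₀`.
  obtain ⟨n, ⟨⟨⟨h3, h4⟩, h5⟩, h6⟩, h7⟩ := ((((h1.eventually_const_lt
    (show (3 / 4 : ℝ) < 1 by norm_num)).and (h2.eventually_lt_const
    (show (1 : ℝ) < 5 / 4 by norm_num))).and (hW.eventually_gt_atTop (6 * weight 1 N))).and
    (hE.eventually_gt_atTop 0)).and (eventually_ge_atTop N) |>.exists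
  obtain ⟨m, rfl⟩ := Nat.exists_eq_add_of_le h7
  have h8 := weight_nonneg 1 N
  rw [lt_div_iff₀ h6] at h3
  rw [div_lt_iff₀ (by linarith)] at h4
  have := hexp m
  linarith

/-! ### Distribution normality -/

/-- At a position of class `c`, the shifted number lies in a short interval near `c / i`. -/
theorem shiftT_mem_of_class {g : ℕ → ℕ → ℕ} (hg : IsGrouping g) {i r u : ℕ} (hi : 6 ≤ i)
    (hr : r < reps i) (hu : u < (blockW i).length) (hui : (blockW i).getD u 0 = i) :
    ((g i u : ℝ) - 1) / i ≤ shiftT (seqQ g) (start i + r * (blockW i).length + u)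
        (psi seqP (seqQ g) zeta) ∧
      shiftT (seqQ g) (start i + r * (blockW i).length + u) (psi seqP (seqQ g) zeta)
        < ((g i u : ℝ) + 1) / i := by
  have h1 := digits_div_le_shiftT (isBasic_seqQ hg) (psi seqP (seqQ g) zeta)
    (start i + r * (blockW i).length + u)
  have hi0 : (0 : ℝ) < i := by positivity
  rw [digits_psi hg, zetaDigits_offset hr hu, hui, seqQ_offset g hr hu, hui,
    if_neg (lt_irrefl _)] at h1
  obtain ⟨hc1, hci⟩ := Finset.mem_Icc.1 (hg.mem i hi u hu hui)
  rcases Nat.eq_or_lt_of_le hc1 with hc | hc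
  · rw [if_pos hc.symm] at h1
    rw [← hc]
    refine ⟨le_trans (by simp) (le_trans (by positivity : (0 : ℝ) ≤ i / (i ^ 3 : ℕ)) h1.1),
      h1.2.trans_le ?_⟩
    have h6 : (6 : ℝ) ≤ i := by exact_mod_cast hi
    push_cast
    rw [div_le_div_iff₀ (by positivity) hi0]
    nlinarith [mul_pos hi0 hi0]
  · obtain ⟨m, hm⟩ : ∃ m, g i u = m + 1 := ⟨g i u - 1, by omega⟩
    rw [if_neg (by omega), hm, Nat.add_sub_cancel] at h1
    have hm1 : 1 ≤ m := by omega
    have hq1 := lt_sq_div hm1 (show m < i by omega)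
    have hq2 : m * (i ^ 2 / m) ≤ i ^ 2 := Nat.mul_div_le _ _
    have hq3 : i ^ 2 < m * (i ^ 2 / m) + m := Nat.lt_mul_div_succ _ hm1
    generalize i ^ 2 / m = q at h1 hq1 hq2 hq3
    have hq0 : (0 : ℝ) < q := by exact_mod_cast (show 0 < q by omega)
    rw [hm]
    push_cast
    refine ⟨le_trans ?_ h1.1, h1.2.trans_le ?_⟩
    · rw [div_le_div_iff₀ hi0 hq0]
      have : (m * q : ℝ) ≤ i ^ 2 := by exact_mod_cast hq2
      linarith
    · rw [div_le_div_iff₀ hq0 hi0]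
      have : (i + 1) * i ≤ (m + 1 + 1) * q := by nlinarith
      exact_mod_cast this

theorem card_filter_Icc_le {a b : ℝ} (ha : 0 ≤ a) (hab : a ≤ b) (i : ℕ) :
    (((Finset.Icc 1 i).filter
      fun c : ℕ => a * i < (c : ℝ) + 1 ∧ (c : ℝ) - 1 < b * i).card : ℝ)
      ≤ (b - a) * i + 3 := by
  have hai : 0 ≤ a * i := by positivity
  have hbi : a * i ≤ b * i := by gcongr
  have h1 : (Finset.Icc 1 i).filter (fun c : ℕ => a * i < (c : ℝ) + 1 ∧ (c : ℝ) - 1 < b * i)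
      ⊆ Finset.Icc ⌊a * i⌋₊ ⌈b * i⌉₊ := by
    intro c hc
    obtain ⟨-, h2, h3⟩ := Finset.mem_filter.1 hc
    rw [Finset.mem_Icc]
    constructor
    · have : (⌊a * i⌋₊ : ℝ) < c + 1 := (Nat.floor_le hai).trans_lt h2
      exact Nat.lt_succ_iff.1 (by exact_mod_cast this)
    · have : (c : ℝ) < ⌈b * i⌉₊ + 1 := by have := Nat.le_ceil (b * i); linarith
      exact Nat.lt_succ_iff.1 (by exact_mod_cast this)
  have h2 := Finset.card_le_card h1
  have h3 : ⌊a * i⌋₊ ≤ ⌈b * i⌉₊ := (Nat.floor_le_ceil _).trans (Nat.ceil_mono hbi)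
  rw [Nat.card_Icc] at h2
  have h4 := (Nat.cast_le (α := ℝ)).2 h2
  rw [Nat.cast_sub (by omega)] at h4
  push_cast at h4
  have := Nat.ceil_lt_add_one (hai.trans hbi)
  have := Nat.lt_floor_add_one (a * i)
  linarith

theorem le_card_filter_Icc {a b : ℝ} (ha : 0 ≤ a) (hab : a ≤ b) (hb : b ≤ 1) (i : ℕ) :
    (b - a) * i - 3
      ≤ (((Finset.Icc 1 i).filter
        fun c : ℕ => a * i ≤ (c : ℝ) - 1 ∧ (c : ℝ) + 1 ≤ b * i).card : ℝ) := by
  have hai : 0 ≤ a * i := by positivity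
  have hbi : 0 ≤ b * i := mul_nonneg (ha.trans hab) (Nat.cast_nonneg _)
  have h1 : Finset.Ico (⌈a * i⌉₊ + 1) ⌊b * i⌋₊
      ⊆ (Finset.Icc 1 i).filter fun c : ℕ => a * i ≤ (c : ℝ) - 1 ∧ (c : ℝ) + 1 ≤ b * i := by
    intro c hc
    obtain ⟨h2, h3⟩ := Finset.mem_Ico.1 hc
    have h4 : (⌈a * i⌉₊ : ℝ) + 1 ≤ c := by exact_mod_cast h2
    have h5 : (c : ℝ) + 1 ≤ ⌊b * i⌋₊ := by exact_mod_cast h3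
    have h6 := Nat.le_ceil (a * i)
    have h7 := Nat.floor_le hbi
    have h8 : b * i ≤ i := mul_le_of_le_one_left (Nat.cast_nonneg _) hb
    have h9 : c ≤ i := by
      have : (c : ℝ) ≤ i := by linarith
      exact_mod_cast this
    rw [Finset.mem_filter, Finset.mem_Icc]
    exact ⟨⟨by omega, h9⟩, by linarith, by linarith⟩
  have h2 := Finset.card_le_card h1
  rw [Nat.card_Ico] at h2
  have h3 : (⌊b * i⌋₊ : ℝ) ≤
      (((Finset.Icc 1 i).filter
        fun c : ℕ => a * i ≤ (c : ℝ) - 1 ∧ (c : ℝ) + 1 ≤ b * i).card : ℝ)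
        + (⌈a * i⌉₊ + 1) := by
    exact_mod_cast Nat.sub_le_iff_le_add.1 h2
  have := Nat.ceil_lt_add_one hai
  have := Nat.lt_floor_add_one (b * i)
  linarith

/-- In each copy of `W_i`, the shifted number visits `[a, b)` with frequency `b - a`: the `i`
classes have the same size, and class `c` accounts for visits near `c / i`. -/
theorem abs_sum_visits_sub_le {g : ℕ → ℕ → ℕ} (hg : IsGrouping g) {a b : ℝ} (ha : 0 ≤ a)
    (hab : a < b) (hb : b ≤ 1) {i r : ℕ} (hi : 6 ≤ i) (hr : r < reps i) {f : ℕ → ℝ}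
    (hf : ∀ t, f t = if shiftT (seqQ g) t (psi seqP (seqQ g) zeta) ∈ Set.Ico a b then 1 else 0) :
    |∑ u ∈ Finset.range (blockW i).length, f (start i + r * (blockW i).length + u)
      - (b - a) * (blockW i).length| ≤ 3 * classSize i + i ^ 3 * 2 ^ (i ^ 3 - i) := by
  have hi0 : (0 : ℝ) < i := by positivity
  have hf0 : ∀ t, 0 ≤ f t := fun t => by rw [hf]; split_ifs <;> norm_num
  have hf1 : ∀ t, f t ≤ 1 := fun t => by rw [hf]; split_ifs <;> norm_num
  set p := start i + r * (blockW i).length with hp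
  set A := {u ∈ Finset.range (blockW i).length | (blockW i).getD u 0 = i} with hA
  have hfiber : ∀ c ∈ Finset.Icc 1 i, ({u ∈ A | g i u = c}.card : ℝ) = classSize i := by
    intro c hc
    rw [hA, Finset.filter_filter, hg.card i hi c hc, classSize]
  have hclass : ∀ c, ∀ u ∈ {u ∈ A | g i u = c},
      ((c : ℝ) - 1) / i ≤ shiftT (seqQ g) (p + u) (psi seqP (seqQ g) zeta) ∧
        shiftT (seqQ g) (p + u) (psi seqP (seqQ g) zeta) < ((c : ℝ) + 1) / i := by
    intro c u hu
    simp only [hA, Finset.mem_filter, Finset.mem_range] at hu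
    obtain ⟨⟨hu, hui⟩, rfl⟩ := hu
    exact shiftT_mem_of_class hg hi hr hu hui
  have hsumA : ∑ u ∈ A, f (p + u)
      = ∑ c ∈ Finset.Icc 1 i, ∑ u ∈ A with g i u = c, f (p + u) := by
    refine (Finset.sum_fiberwise_of_maps_to (fun u hu => ?_) _).symm
    simp only [hA, Finset.mem_filter, Finset.mem_range] at hu
    exact hg.mem i hi u hu.1 hu.2
  have hupper : ∑ u ∈ A, f (p + u) ≤ classSize i * ((b - a) * i + 3) := by
    refine le_trans ?_ (mul_le_mul_of_nonneg_left (card_filter_Icc_le ha hab.le i)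
      (Nat.cast_nonneg _))
    rw [hsumA, Finset.card_filter, Nat.cast_sum, Finset.mul_sum]
    refine Finset.sum_le_sum fun c hc => ?_
    split_ifs with h
    · rw [Nat.cast_one, mul_one, ← hfiber c hc, Finset.card_eq_sum_ones, Nat.cast_sum, Nat.cast_one]
      exact Finset.sum_le_sum fun u _ => hf1 _
    · rw [Nat.cast_zero, mul_zero]
      refine (Finset.sum_eq_zero fun u hu => ?_).le
      obtain ⟨h1, h2⟩ := hclass c u hu
      rw [hf, if_neg]
      rintro ⟨h3, h4⟩
      refine h ⟨(lt_div_iff₀ hi0).1 (h3.trans_lt h2), (div_lt_iff₀ hi0).1 (h1.trans_lt h4)⟩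
  have hlower : classSize i * ((b - a) * i - 3) ≤ ∑ u ∈ A, f (p + u) := by
    refine (mul_le_mul_of_nonneg_left (le_card_filter_Icc ha hab.le hb i)
      (Nat.cast_nonneg _)).trans ?_
    rw [hsumA, Finset.card_filter, Nat.cast_sum, Finset.mul_sum]
    refine Finset.sum_le_sum fun c hc => ?_
    split_ifs with h
    · rw [Nat.cast_one, mul_one, ← hfiber c hc, Finset.card_eq_sum_ones, Nat.cast_sum, Nat.cast_one]
      refine Finset.sum_le_sum fun u hu => ?_
      obtain ⟨h1, h2⟩ := hclass c u hu
      rw [hf, if_pos]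
      exact ⟨((le_div_iff₀ hi0).2 h.1).trans h1, h2.trans_le ((div_le_iff₀ hi0).2 h.2)⟩
    · rw [Nat.cast_zero, mul_zero]
      exact Finset.sum_nonneg fun u _ => hf0 _
  have hrest : ∑ u ∈ Finset.range (blockW i).length with ¬ (blockW i).getD u 0 = i, f (p + u)
      ≤ i ^ 3 * 2 ^ (i ^ 3 - i) := by
    refine (Finset.sum_le_card_nsmul _ _ 1 fun u _ => hf1 _).trans ?_
    have h1 := Finset.card_filter_add_card_filter_not (s := Finset.range (blockW i).length)
      (fun u => (blockW i).getD u 0 = i)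
    rw [card_filter_getD_blockW, Finset.card_range] at h1
    have h2 := length_blockW_eq i
    rw [nsmul_eq_mul, mul_one]
    exact_mod_cast (show _ ≤ i ^ 3 * 2 ^ (i ^ 3 - i) by omega)
  have hrest0 : 0 ≤ ∑ u ∈ Finset.range (blockW i).length with ¬ (blockW i).getD u 0 = i,
      f (p + u) := Finset.sum_nonneg fun u _ => hf0 _
  have hlen : ((blockW i).length : ℝ) = i * classSize i + i ^ 3 * 2 ^ (i ^ 3 - i) := by
    exact_mod_cast length_blockW_eq i
  rw [← Finset.sum_filter_add_sum_filter_not _ fun u => (blockW i).getD u 0 = i, hlen]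
  have hz : (0 : ℝ) ≤ i ^ 3 * 2 ^ (i ^ 3 - i) := by positivity
  generalize (i ^ 3 * 2 ^ (i ^ 3 - i) : ℝ) = z at *
  have h1 : (b - a) * z ≤ z := mul_le_of_le_one_left hz (by linarith)
  have h2 : 0 ≤ (b - a) * z := mul_nonneg (by linarith) hz
  rw [abs_le]
  constructor <;> nlinarith

theorem visits_error_le {i : ℕ} (hi : 6 ≤ i) :
    (3 * classSize i + i ^ 3 * 2 ^ (i ^ 3 - i) : ℝ) ≤ 4 / i * (blockW i).length := by
  have h1 : i ^ 2 ≤ 2 ^ i := by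
    induction i, hi using Nat.le_induction with
    | base => norm_num
    | succ i hi ih => rw [pow_succ 2 i]; nlinarith
  have h2 : i * (i ^ 3 * 2 ^ (i ^ 3 - i)) ≤ (blockW i).length := by
    rw [length_blockW, two_pow_cube i]
    calc i * (i ^ 3 * 2 ^ (i ^ 3 - i)) = i ^ 2 * (i ^ 2 * 2 ^ (i ^ 3 - i)) := by ring
      _ ≤ i ^ 2 * (2 ^ i * 2 ^ (i ^ 3 - i)) := by gcongr
  have h3 : i * classSize i ≤ (blockW i).length := by have := length_blockW_eq i; omega
  have h2' : (i * (i ^ 3 * 2 ^ (i ^ 3 - i)) : ℝ) ≤ (blockW i).length := by exact_mod_cast h2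
  have h3' : (i * classSize i : ℝ) ≤ (blockW i).length := by exact_mod_cast h3
  have hi0 : (0 : ℝ) < i := by positivity
  rw [div_mul_eq_mul_div, le_div_iff₀ hi0]
  linarith

theorem psi_mem_distributionNormalNumbers {g : ℕ → ℕ → ℕ} (hg : IsGrouping g) :
    psi seqP (seqQ g) zeta ∈ distributionNormalNumbers (seqQ g) := by
  classical
  intro a b ha hab hb
  set f : ℕ → ℝ := fun t =>
    if shiftT (seqQ g) t (psi seqP (seqQ g) zeta) ∈ Set.Ico a b then 1 else 0 with hf
  have hδ : Tendsto (fun i : ℕ => (4 : ℝ) / i) atTop (𝓝 0) :=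
    tendsto_const_div_atTop_nhds_zero_nat 4
  have h := tendsto_sum_div_weight (f := f) (fun t => by simp only [hf]; split_ifs <;> norm_num)
    (fun t => by simp only [hf]; split_ifs <;> norm_num) 0 (b - a) hδ <| by
      filter_upwards [eventually_ge_atTop 6] with i hi r hr
      rw [pow_zero, div_one]
      exact (abs_sum_visits_sub_le hg ha hab hb hi hr fun _ => rfl).trans (visits_error_le hi)
  refine h.congr fun n => ?_
  rw [Finset.card_filter, Nat.cast_sum]
  congr 1
  · refine Finset.sum_congr rfl fun t _ => ?_
    simp only [hf, shiftT, Int.fract_fract]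
    push_cast
    rfl
  · simp [weight]

end CantorSeries

theorem mainTheorem3 :
    (∃ g : ℕ → ℕ → ℕ, CantorSeries.IsGrouping g) ∧
    ∀ g : ℕ → ℕ → ℕ, CantorSeries.IsGrouping g →
      CantorSeries.IsBasic (CantorSeries.seqQ g) ∧
      CantorSeries.InfiniteInLimit (CantorSeries.seqQ g) ∧
      CantorSeries.FullyDivergent (CantorSeries.seqQ g) ∧
      CantorSeries.psi CantorSeries.seqP (CantorSeries.seqQ g) CantorSeries.zeta ∈
        (CantorSeries.ratioNormalNumbers (CantorSeries.seqQ g) ∩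
          CantorSeries.distributionNormalNumbers (CantorSeries.seqQ g)) \
            CantorSeries.normalNumbers (CantorSeries.seqQ g) :=
  ⟨CantorSeries.exists_isGrouping, fun _ hg =>
    ⟨CantorSeries.isBasic_seqQ hg, CantorSeries.infiniteInLimit_seqQ hg,
      CantorSeries.fullyDivergent_seqQ hg,
      ⟨CantorSeries.psi_mem_ratioNormalNumbers hg,
        CantorSeries.psi_mem_distributionNormalNumbers hg⟩,
      CantorSeries.psi_notMem_normalNumbers hg⟩⟩
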